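/- Let $2\le m\le n$ be integers, and let $(P,\chi)$ be linear evolution data with $P$ connected and nonsingular. That is, $P\subset\mathbb R^n$ is a connected (injectively immersed, in particular possibly embedded) smooth submanifold of dimension $m-1$, which is not contained in any proper vector subspace of $\mathbb R^n$, and $\chi:\mathbb R^n\to\Lambda^{m-1}\mathbb R^n$ is a linear map such that $\chi(p)$ is a nonzero element of $\Lambda^{m-1}T_pP\subset\Lambda^{m-1}\mathbb R^n$ for every $p\in P$. Then there is a connected Lie subgroup $G\subset GL(n,\mathbb R)$ (not necessarily closed: a connected Lie group with an injective immersive homomorphism to $GL(n,\mathbb R)$), with Lie algebra $\mathfrak g\subset\mathfrak{gl}(n,\mathbb R)$, such that: (a) $P$ is an open subset of a $G$-orbit $G\cdot x\subset\mathbb R^n$, where the orbit has its topology as the immersed submanifold $G/\mathrm{Stab}_G(x)$ and $P$ has its manifold topology (so that the inclusion of $P$ in the orbit is an open embedding); (b) $\chi$ is $G$-invariant: $\chi(gx)=(\Lambda^{m-1}g)\,\chi(x)$ for all $g\in G$ and $x\in\mathbb R^n$; (c) the natural linear map $L$ defined on $\Lambda^{m-2}(\mathbb R^n)^*$ by contraction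 with $\chi$, that is $L(\alpha)(x)=\chi(x)\cdot\alpha$ for $x\in\mathbb R^n$, takes values in $\mathfrak g$, is surjective onto $\mathfrak g$, and is $G$-equivariant: $L\bigl((g^{-1})^*\alpha\bigr)=g\,L(\alpha)\,g^{-1}$ for all $g\in G$ and $\alpha\in\Lambda^{m-2}(\mathbb R^n)^*$. Here $(v_1\wedge\cdots\wedge v_{m-1})\cdot\alpha=\sum_{i=1}^{m-1}(-1)^{i-1}\alpha(v_1,\ldots,\widehat{v_i},\ldots,v_{m-1})\,v_i$. -/

import Mathlib

open scoped Manifold ContDiff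

noncomputable section

/-- The Euclidean space `ℝⁿ`. -/
abbrev RSpace (n : ℕ) : Type := EuclideanSpace ℝ (Fin n)

/-- `𝔤𝔩(n,ℝ)`: the algebra of linear endomorphisms of `ℝⁿ`. -/
abbrev RglAlg (n : ℕ) : Type := RSpace n →L[ℝ] RSpace n

/-- `GL(n,ℝ)`: the group of invertible linear endomorphisms of `ℝⁿ`. -/
abbrev RGL (n : ℕ) : Type := (RglAlg n)ˣ

/-- Contraction of `(k+1)`-vectors with a `k`-form `α`, with values in `V`. It is the linear map
with `v₀ ∧ ⋯ ∧ v_k ↦ ∑ i, (-1)^i α(v₀, …, v̂ᵢ, …, v_k) vᵢ`,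
see `contractForm_ιMulti` below. -/
def contractForm {V : Type*} [AddCommGroup V] [Module ℝ V] {k : ℕ} (α : V [⋀^Fin k]→ₗ[ℝ] ℝ) :
    ⋀[ℝ]^(k + 1) V →ₗ[ℝ] V :=
  exteriorPower.alternatingMapLinearEquiv
    (AlternatingMap.alternatizeUncurryFin
      { toFun := fun v => (LinearMap.toSpanSingleton ℝ V v).compAlternatingMap α
        map_add' := fun v w => by ext u; simp
        map_smul' := fun c v => by ext u; simp [smul_smul, mul_comm] })

theorem contractForm_ιMulti {V : Type*} [AddCommGroup V] [Module ℝ V] {k : ℕ}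
    (α : V [⋀^Fin k]→ₗ[ℝ] ℝ) (v : Fin (k + 1) → V) :
    contractForm α (exteriorPower.ιMulti ℝ (k + 1) v) =
      ∑ i : Fin (k + 1), (-1 : ℝ) ^ (i : ℕ) • α (fun j => v (i.succAbove j)) • v i := by
  rw [contractForm, exteriorPower.alternatingMapLinearEquiv_apply_ιMulti,
    AlternatingMap.alternatizeUncurryFin_apply]
  refine Finset.sum_congr rfl fun i _ => ?_
  change ((-1 : ℤ) ^ (i : ℕ)) • (α (i.removeNth v) • v i) = _
  rcases Nat.even_or_odd (i : ℕ) with h | h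
  · rw [h.neg_one_pow, h.neg_one_pow, one_smul, one_smul]; rfl
  · rw [h.neg_one_pow, h.neg_one_pow, neg_smul, neg_smul, one_smul, one_smul]; rfl

/-- The differential at `p` of a map from a `d`-manifold to a normed space `F`, as a linear map
from the tangent space of `M` at `p` to `F`. (In Mathlib, the tangent space of `M` at `p` is a copy of
the model space `ℝᵈ`, identified with it by the preferred chart at `p`.) -/
def differentialAt {d : ℕ} {M : Type*} [TopologicalSpace M]
    [ChartedSpace (EuclideanSpace ℝ (Fin d)) M]
    {F : Type*} [NormedAddCommGroup F] [NormedSpace ℝ F] (f : M → F) (p : M) :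
    EuclideanSpace ℝ (Fin d) →ₗ[ℝ] F :=
  (mfderiv (𝓡 d) 𝓘(ℝ, F) f p : EuclideanSpace ℝ (Fin d) →L[ℝ] F).toLinearMap

/-- The map `f` from a smooth `d`-manifold (without boundary) to a normed space is an injective
smooth immersion. -/
structure IsInjectiveImmersion {d : ℕ} {M : Type*} [TopologicalSpace M]
    [ChartedSpace (EuclideanSpace ℝ (Fin d)) M]
    {F : Type*} [NormedAddCommGroup F] [NormedSpace ℝ F] (f : M → F) : Prop where
  contMDiff : ContMDiff (𝓡 d) 𝓘(ℝ, F) ∞ f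
  injective_differential : ∀ p : M, Function.Injective (differentialAt (d := d) f p)
  injective : Function.Injective f

/-- `(P, χ)` is a set of linear evolution data with `P` nonsingular, of dimension `m - 1`, where
`m = k + 2 ≤ n`. Here the `(k+1)`-dimensional submanifold `P` of `ℝⁿ` is the image of the injective
immersion `ι : M → ℝⁿ`, with the topology and the smooth structure of the manifold `M`; for an
embedded submanifold, `M` is `P` itself and `ι` is the inclusion. -/
structure IsNonsingularLinearEvolutionData {k n : ℕ} {M : Type*} [TopologicalSpace M]
    [ChartedSpace (EuclideanSpace ℝ (Fin (k + 1))) M] [IsManifold (𝓡 (k + 1)) ∞ M]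
    (ι : M → RSpace n) (χ : RSpace n →ₗ[ℝ] ⋀[ℝ]^(k + 1) (RSpace n)) : Prop where
  dim_le : k + 2 ≤ n
  immersion : IsInjectiveImmersion (d := k + 1) ι
  /-- `χ(p)` does not vanish for `p ∈ P`. -/
  ne_zero : ∀ p : M, χ (ι p) ≠ 0
  /-- `χ(p)` lies in `Λ^(m-1) T_p P`, which is the image of `Λ^(m-1)` of the tangent space of `M`
  under the differential of `ι`, for `p ∈ P`. -/
  tangent : ∀ p : M, χ (ι p) ∈
    LinearMap.range (exteriorPower.map (k + 1) (differentialAt (d := k + 1) ι p))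
  /-- `P` is contained in no proper vector subspace of `ℝⁿ`. -/
  not_in_proper : ∀ W : Submodule ℝ (RSpace n), Set.range ι ⊆ (W : Set (RSpace n)) → W = ⊤

/-- A connected Lie subgroup of `GL(n,ℝ)`: a connected Lie group `G` with an injective homomorphism
to `GL(n,ℝ)` that is an immersion. The topology of `G` is its own and need not be the
topology induced from `GL(n,ℝ)`. As `GL(n,ℝ)` is open in `𝔤𝔩(n,ℝ)`, being an immersion
is tested in `𝔤𝔩(n,ℝ)`. -/
structure ConnectedLieSubgroupGL (n : ℕ) where
  dim : ℕ
  G : Type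
  [group : Group G]
  [topologicalSpace : TopologicalSpace G]
  [chartedSpace : ChartedSpace (EuclideanSpace ℝ (Fin dim)) G]
  [lieGroup : LieGroup (𝓡 dim) ∞ G]
  [connectedSpace : ConnectedSpace G]
  incl : G →* RGL n
  immersion : IsInjectiveImmersion (d := dim) (fun g : G => (incl g : RglAlg n))

namespace ConnectedLieSubgroupGL

attribute [instance] group topologicalSpace chartedSpace lieGroup connectedSpace

variable {n : ℕ} (S : ConnectedLieSubgroupGL n)

/-- The linear endomorphism of `ℝⁿ` given by an element of the group. -/
def toEnd (g : S.G) : RglAlg n := (S.incl g : RglAlg n)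

/-- The Lie algebra of the Lie subgroup as a subspace of `𝔤𝔩(n,ℝ)`: the tangent space to the
group at the identity. -/
def lieAlgebra : Submodule ℝ (RglAlg n) :=
  LinearMap.range (differentialAt (d := S.dim) S.toEnd (1 : S.G))

/-- The orbit of `x` in `ℝⁿ`. -/
def orbit (x : RSpace n) : Set (RSpace n) := Set.range fun g : S.G => S.toEnd g x

/-- The topology of the orbit of `x` as an immersed submanifold `G / Stab(x)` of `ℝⁿ`: the quotient
topology for `g ↦ g x`, which may be finer than the subspace topology. -/
abbrev orbitTopology (x : RSpace n) : TopologicalSpace (S.orbit x) :=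
  TopologicalSpace.coinduced (Set.rangeFactorization fun g : S.G => S.toEnd g x) inferInstance

/-- The image of `ι : M → ℝⁿ`, with the topology of `M`, is an open subset of the orbit of `x`, the
latter with its topology as an immersed submanifold. -/
def IsOpenInOrbit {M : Type*} [TopologicalSpace M] (ι : M → RSpace n) (x : RSpace n) : Prop :=
  ∃ h : ∀ p : M, ι p ∈ S.orbit x,
    @Topology.IsOpenEmbedding M (S.orbit x) _ (S.orbitTopology x) fun p => ⟨ι p, h p⟩

end ConnectedLieSubgroupGL

end

/-! ### Multilinear algebra of contractions and derivations on exterior powers -/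

noncomputable section

section Algebra

variable {V W N : Type*} [AddCommGroup V] [Module ℝ V] [AddCommGroup W] [Module ℝ W]
  [AddCommGroup N] [Module ℝ N] {k : ℕ}

/-! For a constant form `α` put `A_α x = contractForm α (χ x)`, a linear vector field on `ℝⁿ`. At `p
∈ P` the multivector `χ p` is a nonzero top multivector of `T_p P`, so every `A_α` is tangent to `P`
and the vectors `A_α p` fill `T_p P` (`contractForm_mem_range`, `exists_contractForm_eq`).

The heart is that `A_α` preserves `χ`. Let `Ω` be the volume form on `P` dual to `χ`. Contracting
`Ω` with `A_α` gives the restriction of `α` up to sign, and this is closed because `α` is constant;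
so `A_α` is divergence free on `P`. Since `χ` and `A_α` are linear, this reads `χ (A_α p) = A_α · χ
p`, with `A_α` acting as a derivation (`apply_contractForm_eq_exteriorDerivation`). Both sides are
linear in `p` and `P` spans `ℝⁿ`, so the identity holds everywhere, and it integrates: `exp A_α`
preserves `χ` (`apply_exp_eq_map_exp`).

Contraction is natural, so conjugating `A_β` by `exp A_α` gives another contraction of `χ`. Thus the
space `𝔤` of all `A_α` is stable under conjugation by its own exponentials, and no Lie bracket is
needed. For such a subspace `exp (-a) * d exp_a` preserves `𝔤` (`exp_neg_mul_fderiv_exp_mem`), so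
small products of exponentials are again exponentials (`exists_local_log`). The group generated by
`exp 𝔤`, with exponentials of balls as neighbourhoods of `1`, is then a connected Lie group with Lie
algebra `𝔤`.

Finally, flows of fields tangent to `P` that start on `P` remain there for short time
(`exists_leftInverse_of_immersion`), and they sweep out a neighbourhood in `P` because the fields
span the tangent space (`exists_lift_exp_apply`). So the points of `P` in one orbit form a clopen
subset of `P`, hence all of `P`, and `P` is open in that orbit. -/

theorem contractForm_add (α β : V [⋀^Fin k]→ₗ[ℝ] ℝ) :
    contractForm (α + β) = contractForm α + contractForm β := by
  apply exteriorPower.linearMap_ext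
  ext v
  simp [contractForm_ιMulti, add_smul, Finset.sum_add_distrib]

theorem contractForm_smul (c : ℝ) (α : V [⋀^Fin k]→ₗ[ℝ] ℝ) :
    contractForm (c • α) = c • contractForm α := by
  apply exteriorPower.linearMap_ext
  ext v
  simp [contractForm_ιMulti, Finset.smul_sum, mul_smul, smul_comm c]

/-- Contraction is natural with respect to linear maps. -/
theorem contractForm_map (f : V →ₗ[ℝ] W) (α : W [⋀^Fin k]→ₗ[ℝ] ℝ) (η : ⋀[ℝ]^(k + 1) V) :
    contractForm α (exteriorPower.map (k + 1) f η) =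
      f (contractForm (α.compLinearMap f) η) := by
  suffices h : contractForm α ∘ₗ exteriorPower.map (k + 1) f =
      f ∘ₗ contractForm (α.compLinearMap f) from LinearMap.congr_fun h η
  apply exteriorPower.linearMap_ext
  ext v
  simp [contractForm_ιMulti, exteriorPower.map_apply_ιMulti, Function.comp_def]

/-- The derivative of an alternating map along a linear endomorphism of the source:
`v ↦ ∑ j, β (v₀, …, A vⱼ, …)`. -/
def AlternatingMap.derivAlong {m : ℕ} (A : V →ₗ[ℝ] V) (β : V [⋀^Fin m]→ₗ[ℝ] N) :
    V [⋀^Fin m]→ₗ[ℝ] N :=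
  { ∑ j : Fin m, β.toMultilinearMap.compLinearMap
      (Function.update (fun _ => LinearMap.id) j A) with
    map_eq_zero_of_eq' := by
      intro v a b hab hne
      have key : ∀ j, (fun i => (Function.update (fun _ => (LinearMap.id : V →ₗ[ℝ] V)) j A) i (v i))
          = Function.update v j (A (v j)) := by
        intro j; ext i
        rcases eq_or_ne i j with rfl | h
        · simp
        · simp [h]
      simp only [MultilinearMap.toFun_eq_coe, sum_apply,
        MultilinearMap.compLinearMap_apply, key, AlternatingMap.coe_multilinearMap]
      -- Only the summands at `a` and `b` survive the repeated vector; a transposition exchanges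
      -- these two, so they cancel.
      rw [← Finset.add_sum_erase _ _ (Finset.mem_univ a),
        ← Finset.add_sum_erase _ _ (Finset.mem_erase.2 ⟨hne.symm, Finset.mem_univ b⟩),
        Finset.sum_eq_zero, add_zero]
      · have h := β.map_swap (Function.update v a (A (v a))) hne
        have h2 : (Function.update v a (A (v a))) ∘ Equiv.swap a b =
            Function.update v b (A (v b)) := by
          ext i
          rcases eq_or_ne i a with rfl | hia
          · simp [hne, hne.symm, hab]
          · rcases eq_or_ne i b with rfl | hib
            · simp [hab]
            · simp [Equiv.swap_apply_of_ne_of_ne hia hib, hia, hib]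
        rw [h2] at h
        rw [h, add_neg_cancel]
      · intro j hj
        simp only [Finset.mem_erase, Finset.mem_univ, and_true] at hj
        exact β.map_eq_zero_of_eq _ (by simp [hj.1.symm, hj.2.symm, hab]) hne }

theorem AlternatingMap.derivAlong_apply {m : ℕ} (A : V →ₗ[ℝ] V) (β : V [⋀^Fin m]→ₗ[ℝ] N)
    (v : Fin m → V) :
    β.derivAlong A v = ∑ j, β (Function.update v j (A (v j))) := by
  change (∑ j : Fin m, β.toMultilinearMap.compLinearMap
      (Function.update (fun _ => LinearMap.id) j A)) v = _
  rw [sum_apply]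
  refine Finset.sum_congr rfl fun j _ => ?_
  rw [MultilinearMap.compLinearMap_apply, AlternatingMap.coe_multilinearMap]
  congr 1
  ext i
  rcases eq_or_ne i j with rfl | h
  · simp
  · simp [h]

/-- The derivation of the exterior power induced by a linear endomorphism. -/
def exteriorDerivation (m : ℕ) (A : V →ₗ[ℝ] V) : ⋀[ℝ]^m V →ₗ[ℝ] ⋀[ℝ]^m V :=
  exteriorPower.alternatingMapLinearEquiv ((exteriorPower.ιMulti ℝ m).derivAlong A)

theorem exteriorDerivation_ιMulti (m : ℕ) (A : V →ₗ[ℝ] V) (v : Fin m → V) :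
    exteriorDerivation m A (exteriorPower.ιMulti ℝ m v) =
      ∑ j, exteriorPower.ιMulti ℝ m (Function.update v j (A (v j))) := by
  rw [exteriorDerivation, exteriorPower.alternatingMapLinearEquiv_apply_ιMulti,
    AlternatingMap.derivAlong_apply]

/-- Linear functionals separate points of exterior powers, in terms of alternating maps. -/
theorem exteriorPower_eq_of_forall {m : ℕ} {x y : ⋀[ℝ]^m V}
    (h : ∀ β : V [⋀^Fin m]→ₗ[ℝ] ℝ, exteriorPower.alternatingMapLinearEquiv β x =
      exteriorPower.alternatingMapLinearEquiv β y) : x = y := by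
  rw [← sub_eq_zero]
  refine (Module.forall_dual_apply_eq_zero_iff ℝ _).1 fun φ => ?_
  have := h (exteriorPower.alternatingMapLinearEquiv.symm φ)
  simp only [LinearEquiv.apply_symm_apply] at this
  rw [map_sub, this, sub_self]

/-- The top exterior power is spanned by the wedge product of a basis. -/
theorem exists_smul_ιMulti_basis {m : ℕ} (b : Module.Basis (Fin m) ℝ V) (η : ⋀[ℝ]^m V) :
    ∃ c : ℝ, η = c • exteriorPower.ιMulti ℝ m b := by
  have h : exteriorPower.ιMulti ℝ m (M := V) =
      (LinearMap.toSpanSingleton ℝ _ (exteriorPower.ιMulti ℝ m b)).compAlternatingMap b.det := by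
    apply Module.Basis.ext_alternating b
    intro i hi
    let σ : Equiv.Perm (Fin m) := Equiv.ofBijective i (Finite.injective_iff_bijective.1 hi)
    change exteriorPower.ιMulti ℝ m (b ∘ σ) = b.det (b ∘ σ) • exteriorPower.ιMulti ℝ m b
    rw [AlternatingMap.map_perm, AlternatingMap.map_perm, b.det_self]
    rcases Int.units_eq_one_or (Equiv.Perm.sign σ) with h | h
    · simp [h]
    · rw [h, Units.neg_smul, one_smul, Units.neg_smul, one_smul]; exact (neg_one_smul ℝ _).symm
  have hη : η ∈ Submodule.span ℝ {exteriorPower.ιMulti ℝ m b} := by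
    have hspan := exteriorPower.ιMulti_span ℝ m V
    have hle : Submodule.span ℝ (Set.range (exteriorPower.ιMulti ℝ m (M := V))) ≤
        Submodule.span ℝ {exteriorPower.ιMulti ℝ m b} := by
      rw [Submodule.span_le]
      rintro _ ⟨v, rfl⟩
      exact Submodule.mem_span_singleton.2 ⟨b.det v, by exact (congrArg (fun f => f v) h).symm⟩
    exact hle (hspan ▸ Submodule.mem_top)
  obtain ⟨c, hc⟩ := Submodule.mem_span_singleton.1 hη
  exact ⟨c, hc.symm⟩

/-- Cramer's rule: moving `w` into slot `i` absorbs the sign `(-1)^i`, and the determinant of the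
basis with `b i` replaced by `w` is the `i`-th coordinate of `w`. This makes contraction with a top
multivector surjective. -/
theorem contractForm_det_curryLeft (b : Module.Basis (Fin (k + 1)) ℝ V) (w : V) :
    contractForm (b.det.curryLeft w) (exteriorPower.ιMulti ℝ (k + 1) b) = w := by
  suffices h : ∀ i : Fin (k + 1), (-1 : ℝ) ^ (i : ℕ) • b.det.curryLeft w (fun j => b (i.succAbove j)) =
      b.repr w i by
    rw [contractForm_ιMulti]
    conv_rhs => rw [← b.sum_repr w]
    refine Finset.sum_congr rfl fun i _ => ?_
    rw [← h i, smul_assoc]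
  intro i
  have h := b.det.neg_one_pow_smul_map_insertNth i w (fun j => b (i.succAbove j))
  rw [AlternatingMap.curryLeft_apply_apply, ← h]
  have h2 : i.insertNth w (fun j => b (i.succAbove j)) = Function.update b i w := by
    exact Fin.insertNth_removeNth i w b
  rw [h2]
  have h3 : b.det (Function.update b i w) = b.repr w i := by
    have := congrArg (fun x => b.det (Function.update b i x)) (b.sum_repr w)
    rw [← this, b.det.map_update_sum, Finset.sum_eq_single i]
    · rw [b.det.map_update_smul, Function.update_eq_self, b.det_self, smul_eq_mul, mul_one]
    · intro j _ hj
      rw [b.det.map_update_smul, b.det.map_update_self _ hj.symm, smul_zero]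
    · simp
  rw [h3]
  rcases Nat.even_or_odd (i : ℕ) with h | h <;> simp [h.neg_one_pow]

end Algebra
end

/-! ### Integral curves of linear fields tangent to an immersed image -/

noncomputable section
open Filter Topology Set

/-- Let `f` be an immersion at `u₀`. There is a smooth local left inverse `r` of `f` such that
curves near `f u₀` which start on the image of `f` and which are integral curves of linear vector
fields tangent to the image of `f` stay on the image of `f`. -/
theorem exists_leftInverse_of_immersion {E F : Type*} [NormedAddCommGroup E] [NormedSpace ℝ E]
    [FiniteDimensional ℝ E] [NormedAddCommGroup F] [NormedSpace ℝ F] [FiniteDimensional ℝ F]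
    {n : WithTop ℕ∞} (hn : 2 ≤ n) {f : E → F} {u₀ : E} (hf : ContDiffAt ℝ n f u₀)
    (hinj : Function.Injective (fderiv ℝ f u₀)) {U : Set E} (hU : U ∈ 𝓝 u₀) :
    ∃ (r : F → E) (B : Set F), ContDiffAt ℝ n r (f u₀) ∧ (∀ᶠ u in 𝓝 u₀, r (f u) = u) ∧
      B ∈ 𝓝 (f u₀) ∧
      ∀ X : F →L[ℝ] F, (∀ u ∈ U, X (f u) ∈ LinearMap.range (fderiv ℝ f u).toLinearMap) →
        ∀ y : ℝ → F, (∀ t ∈ Icc (0 : ℝ) 1, HasDerivAt y (X (y t)) t) →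
          (∀ t ∈ Icc (0 : ℝ) 1, y t ∈ B) → f (r (y 0)) = y 0 → f (r (y 1)) = y 1 := by
  have : CompleteSpace E := FiniteDimensional.complete ℝ E
  have : CompleteSpace F := FiniteDimensional.complete ℝ F
  have hn1 : 1 ≤ n := le_trans (by norm_num) hn
  have hn0 : n ≠ 0 := by rintro rfl; simp at hn
  set D := fderiv ℝ f u₀ with hD
  obtain ⟨C, hC⟩ := Submodule.exists_isCompl (LinearMap.range D.toLinearMap)
  let e₀ : (E × C) ≃ₗ[ℝ] F :=
    ((LinearEquiv.ofInjective D.toLinearMap hinj).prodCongr (LinearEquiv.refl ℝ C)).trans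
      (Submodule.prodEquivOfIsCompl _ C hC)
  let e : (E × C) ≃L[ℝ] F := e₀.toContinuousLinearEquiv
  -- Straightening: with `C` a complement of the tangent space, `Φ` is a local diffeomorphism. Its
  -- inverse splits as `(r, z)`, and near `f u₀` the local image of `f` is `z = 0`.
  let Φ : E × C → F := fun p => f p.1 + p.2
  have hΦs : ContDiffAt ℝ n Φ (u₀, 0) := by
    refine ContDiffAt.add ?_ ?_
    · exact ContDiffAt.comp (u₀, (0 : C)) (f := Prod.fst) (g := f) hf contDiffAt_fst
    · exact (C.subtypeL.contDiff.comp contDiff_snd).contDiffAt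
  have hΦd : HasFDerivAt Φ (e : E × C →L[ℝ] F) (u₀, 0) := by
    have h1 : HasFDerivAt f D u₀ := (hf.differentiableAt hn0).hasFDerivAt
    have h2 := (HasFDerivAt.comp (u₀, (0 : C)) (f := Prod.fst) h1 hasFDerivAt_fst).add
      (C.subtypeL.comp (ContinuousLinearMap.snd ℝ E C)).hasFDerivAt
    refine h2.congr_fderiv ?_
    ext p <;> simp [e, e₀]
  let G := hΦs.localInverse hΦd hn0
  have hΦ0 : Φ (u₀, 0) = f u₀ := by simp [Φ]
  have hG : ContDiffAt ℝ n G (f u₀) := hΦ0 ▸ hΦs.to_localInverse hΦd hn0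
  have hG0 : G (f u₀) = (u₀, 0) := hΦ0 ▸ hΦs.localInverse_apply_image hΦd hn0
  have hst := hΦs.hasStrictFDerivAt' hΦd hn0
  have hleft : ∀ᶠ p in 𝓝 (u₀, (0 : C)), G (Φ p) = p := hst.eventually_left_inverse
  have hright : ∀ᶠ y in 𝓝 (f u₀), Φ (G y) = y := hΦ0 ▸ hst.eventually_right_inverse
  let r : F → E := fun y => (G y).1
  let z : F → C := fun y => (G y).2
  have hr : ContDiffAt ℝ n r (f u₀) := contDiffAt_fst.comp _ hG
  have hz : ContDiffAt ℝ n z (f u₀) := contDiffAt_snd.comp _ hG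
  have hr0 : r (f u₀) = u₀ := by simp [r, hG0]
  have hleftf : ∀ᶠ u in 𝓝 u₀, G (f u) = (u, 0) := by
    have ht : Tendsto (fun u : E => (u, (0 : C))) (𝓝 u₀) (𝓝 (u₀, 0)) :=
      (continuous_id.prodMk continuous_const).tendsto _
    filter_upwards [ht.eventually hleft] with u hu
    simpa [Φ] using hu
  -- the derivative of `z` vanishes on tangent vectors
  have hzd : ContDiffAt ℝ 1 (fderiv ℝ z) (f u₀) := by
    exact hz.fderiv_right (m := 1) (by rwa [one_add_one_eq_two])
  obtain ⟨K, s, hs, hK⟩ := hzd.exists_lipschitzOnWith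
  have hzdiff : ∀ᶠ y in 𝓝 (f u₀), DifferentiableAt ℝ z y := by
    filter_upwards [(hz.of_le hn1).eventually (by simp)] with y hy
    exact hy.differentiableAt one_ne_zero
  have hfdiff : ∀ᶠ u in 𝓝 u₀, DifferentiableAt ℝ f u := by
    filter_upwards [(hf.of_le hn1).eventually (by simp)] with y hy
    exact hy.differentiableAt one_ne_zero
  have hfc : ContinuousAt f u₀ := hf.continuousAt
  have htan : ∀ᶠ u in 𝓝 u₀, ∀ v, fderiv ℝ z (f u) (fderiv ℝ f u v) = 0 := by
    filter_upwards [hleftf.eventually_nhds, hfc.eventually hzdiff, hfdiff] with u hu hzu hfu v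
    have h0 : z ∘ f =ᶠ[𝓝 u] fun _ => 0 := by
      filter_upwards [hu] with x hx
      simp [z, hx]
    have h1 := h0.fderiv_eq (𝕜 := ℝ)
    rw [fderiv_comp u hzu hfu] at h1
    simpa using congrArg (fun T => T v) h1
  have hbd : ∀ᶠ y in 𝓝 (f u₀), ‖fderiv ℝ z y‖ < ‖fderiv ℝ z (f u₀)‖ + 1 :=
    have hc : ContinuousAt (fun y => ‖fderiv ℝ z y‖) (f u₀) :=
      ContinuousAt.norm (E := F →L[ℝ] C) hzd.continuousAt
    hc.eventually (gt_mem_nhds (lt_add_one _))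
  have hnorm : ∀ᶠ y in 𝓝 (f u₀), ‖y‖ < ‖f u₀‖ + 1 :=
    continuousAt_id.norm.eventually (gt_mem_nhds (lt_add_one _))
  have hrc : Tendsto r (𝓝 (f u₀)) (𝓝 u₀) := by
    have := hr.continuousAt.tendsto; rwa [hr0] at this
  have hfr : Tendsto (fun y => f (r y)) (𝓝 (f u₀)) (𝓝 (f u₀)) := hfc.tendsto.comp hrc
  -- The neighbourhood is fixed before any field `X` is chosen, so one `B` serves all tangent linear
  -- fields.
  have hB : ∀ᶠ y in 𝓝 (f u₀), Φ (G y) = y ∧ DifferentiableAt ℝ z y ∧ y ∈ s ∧ f (r y) ∈ s ∧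
      ‖fderiv ℝ z (f (r y))‖ < ‖fderiv ℝ z (f u₀)‖ + 1 ∧ ‖y‖ < ‖f u₀‖ + 1 ∧ r y ∈ U ∧
      ∀ v, fderiv ℝ z (f (r y)) (fderiv ℝ f (r y) v) = 0 := by
    filter_upwards [hright, hzdiff, hs, hfr hs, hfr.eventually hbd, hnorm, hrc hU,
      hrc.eventually htan] with y h1 h2 h3 h4 h5 h6 h7 h8
    exact ⟨h1, h2, h3, h4, h5, h6, h7, h8⟩
  refine ⟨r, _, hr, hleftf.mono fun u hu => by simp [r, hu], hB, fun X hX y hy hyB hy0 => ?_⟩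
  have hΦG : ∀ t ∈ Icc (0 : ℝ) 1, f (r (y t)) + z (y t) = y t := fun t ht => (hyB t ht).1
  have hzy : ∀ t ∈ Icc (0 : ℝ) 1,
      HasDerivAt (fun t => z (y t)) (fderiv ℝ z (y t) (X (y t))) t := fun t ht =>
    (hyB t ht).2.1.hasFDerivAt.comp_hasDerivAt t (hy t ht)
  have hz0 : z (y 0) = 0 := by
    have := hΦG 0 (by simp)
    rw [hy0] at this
    simpa using this
  -- The derivative of `z` along `X` vanishes on the image of `f`, where `X` is tangent. Comparing
  -- `y t` with `f (r (y t))`, which is at distance `‖z (y t)‖`, bounds it by a multiple of `‖z (y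
  -- t)‖`; as `z (y 0) = 0`, Grönwall forces `z (y t) = 0`.
  have hbound : ∀ t ∈ Icc (0 : ℝ) 1, ‖fderiv ℝ z (y t) (X (y t))‖ ≤
      (K * ‖X‖ * (‖f u₀‖ + 1) + (‖fderiv ℝ z (f u₀)‖ + 1) * ‖X‖) * ‖z (y t)‖ := by
    intro t ht
    obtain ⟨h1, h2, h3, h4, h5, h6, h7, h8⟩ := hyB t ht
    obtain ⟨v, hv⟩ := hX _ h7
    have h0 : fderiv ℝ z (f (r (y t))) (X (f (r (y t)))) = 0 := by
      rw [← hv]; exact h8 v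
    have hsub : y t - f (r (y t)) = z (y t) := by
      rw [sub_eq_iff_eq_add', hΦG t ht]
    have hdist : ‖y t - f (r (y t))‖ = ‖z (y t)‖ := by rw [hsub]; rfl
    have hsplit : fderiv ℝ z (y t) (X (y t)) =
        (fderiv ℝ z (y t) - fderiv ℝ z (f (r (y t)))) (X (y t)) +
        fderiv ℝ z (f (r (y t))) (X (y t - f (r (y t)))) := by
      simp [h0]
    have hL := hK.dist_le_mul _ h3 _ h4
    rw [dist_eq_norm, dist_eq_norm, hdist] at hL
    rw [hsplit]
    have e1 : ‖(fderiv ℝ z (y t) - fderiv ℝ z (f (r (y t)))) (X (y t))‖ ≤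
        (K * ‖z (y t)‖) * (‖X‖ * (‖f u₀‖ + 1)) := by
      refine (ContinuousLinearMap.le_opNorm _ _).trans ?_
      refine mul_le_mul hL ?_ (norm_nonneg _) (by positivity)
      exact (X.le_opNorm _).trans (by gcongr)
    have e2 : ‖fderiv ℝ z (f (r (y t))) (X (y t - f (r (y t))))‖ ≤
        (‖fderiv ℝ z (f u₀)‖ + 1) * (‖X‖ * ‖z (y t)‖) := by
      refine (ContinuousLinearMap.le_opNorm _ _).trans ?_
      refine mul_le_mul h5.le ?_ (norm_nonneg _) (by positivity)
      exact (X.le_opNorm _).trans (by rw [hdist])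
    refine (norm_add_le _ _).trans ((add_le_add e1 e2).trans (le_of_eq (by ring)))
  have hz1 := eq_zero_of_abs_deriv_le_mul_abs_self_of_eq_zero_right
    (f := fun t => z (y t)) (a := 0) (b := 1)
    (fun t ht => (hzy t ht).continuousAt.continuousWithinAt)
    (fun t ht => (hzy t (Ico_subset_Icc_self ht)).hasDerivWithinAt) hz0
    (fun t ht => hbound t (Ico_subset_Icc_self ht)) 1 (by simp)
  have := hΦG 1 (by simp)
  rw [hz1] at this
  simpa using this

end

/-! ### The logarithmic derivative of the exponential -/

noncomputable section
open Filter Topology Set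

section Exponential

variable {𝔸 : Type*} [NormedRing 𝔸] [NormedAlgebra ℝ 𝔸] [FiniteDimensional ℝ 𝔸]

theorem exp_mul_exp_neg (x : 𝔸) : NormedSpace.exp x * NormedSpace.exp (-x) = 1 := by
  let _ := NormedAlgebra.restrictScalars ℚ ℝ 𝔸
  have : CompleteSpace 𝔸 := FiniteDimensional.complete ℝ 𝔸
  rw [← NormedSpace.exp_add_of_commute (Commute.neg_right (Commute.refl x)), add_neg_cancel,
    NormedSpace.exp_zero]

theorem exp_neg_mul_exp (x : 𝔸) : NormedSpace.exp (-x) * NormedSpace.exp x = 1 := by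
  simpa using exp_mul_exp_neg (-x)

theorem contDiff_exp_of_finiteDimensional {n : WithTop ℕ∞} :
    ContDiff ℝ n (NormedSpace.exp : 𝔸 → 𝔸) := by
  have : CompleteSpace 𝔸 := FiniteDimensional.complete ℝ 𝔸
  have h : ContDiff ℝ ω (NormedSpace.exp : 𝔸 → 𝔸) := contDiff_iff_contDiffAt.2 fun x =>
    (NormedSpace.exp_analytic (𝕂 := ℝ) x).contDiffAt
  exact h.of_le le_top

theorem hasDerivAt_exp_neg_smul (x : 𝔸) (t : ℝ) :
    HasDerivAt (fun s : ℝ => NormedSpace.exp (-(s • x))) (-(NormedSpace.exp (-(t • x)) * x)) t := by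
  have : CompleteSpace 𝔸 := FiniteDimensional.complete ℝ 𝔸
  simpa using hasDerivAt_exp_smul_const (𝕂 := ℝ) (-x) t

/-- If a subspace is invariant under conjugation by the exponentials of its elements, then the
logarithmic derivative of the exponential maps it to itself. -/
theorem exp_neg_mul_fderiv_exp_mem {𝔤 : Submodule ℝ 𝔸}
    (hAd : ∀ X ∈ 𝔤, ∀ Y ∈ 𝔤, NormedSpace.exp (-X) * Y * NormedSpace.exp X ∈ 𝔤)
    {a c : 𝔸} (ha : a ∈ 𝔤) (hc : c ∈ 𝔤) :
    NormedSpace.exp (-a) * fderiv ℝ NormedSpace.exp a c ∈ 𝔤 := by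
  have : CompleteSpace 𝔸 := FiniteDimensional.complete ℝ 𝔸
  have : ProperSpace 𝔸 := FiniteDimensional.proper ℝ 𝔸
  by_contra hx
  obtain ⟨φ₀, hφx, hφ⟩ := Submodule.exists_le_ker_of_notMem hx
  let φ : 𝔸 →L[ℝ] ℝ := LinearMap.toContinuousLinearMap φ₀
  have hφ𝔤 : ∀ x ∈ 𝔤, φ x = 0 := fun x hx => hφ hx
  -- This radius contains `s • a` and `s • (a + ε • c)` whenever `|s| ≤ 1` and `|ε| ≤ 1`.
  set R := ‖a‖ + ‖c‖
  have hR : 0 ≤ R := by positivity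
  obtain ⟨K, hK⟩ : ∃ K, LipschitzOnWith K (NormedSpace.exp : 𝔸 → 𝔸) (Metric.closedBall 0 R) := by
    obtain ⟨K, hK⟩ := (isCompact_closedBall (0 : 𝔸) R).exists_bound_of_continuousOn
      (f := fun x => fderiv ℝ (NormedSpace.exp : 𝔸 → 𝔸) x)
      ((contDiff_exp_of_finiteDimensional (n := 1)).continuous_fderiv one_ne_zero).continuousOn
    refine ⟨K.toNNReal, (convex_closedBall 0 R).lipschitzOnWith_of_nnnorm_fderiv_le
      (fun x _ => contDiff_exp_of_finiteDimensional.differentiable one_ne_zero x) fun x hx => ?_⟩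
    exact NNReal.le_toNNReal_of_coe_le (hK x hx)
  set M := ‖(1 : 𝔸)‖ + K * R
  have hM : ∀ x : 𝔸, ‖x‖ ≤ R → ‖NormedSpace.exp x‖ ≤ M := by
    intro x hx
    have h := hK.dist_le_mul x (by simpa using hx) 0 (by simpa using hR)
    rw [dist_eq_norm, dist_eq_norm, NormedSpace.exp_zero, sub_zero] at h
    calc ‖NormedSpace.exp x‖ = ‖1 + (NormedSpace.exp x - 1)‖ := by rw [add_sub_cancel]
      _ ≤ ‖(1 : 𝔸)‖ + ‖NormedSpace.exp x - 1‖ := norm_add_le _ _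
      _ ≤ ‖(1 : 𝔸)‖ + K * R := by gcongr; exact h.trans (by gcongr)
  have hderiv : HasDerivAt
      (fun ε : ℝ => φ (NormedSpace.exp (-a) * NormedSpace.exp (a + ε • c)))
      (φ (NormedSpace.exp (-a) * fderiv ℝ NormedSpace.exp a c)) 0 := by
    have h1 : HasDerivAt (fun ε : ℝ => a + ε • c) c 0 := by
      simpa using ((hasDerivAt_id (0 : ℝ)).smul_const c).const_add a
    have h2 : HasFDerivAt (NormedSpace.exp : 𝔸 → 𝔸) (fderiv ℝ NormedSpace.exp a)
        (a + (0 : ℝ) • c) := by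
      rw [zero_smul, add_zero]
      exact (contDiff_exp_of_finiteDimensional.differentiable one_ne_zero a).hasFDerivAt
    exact φ.hasFDerivAt.comp_hasDerivAt (0 : ℝ) ((h2.comp_hasDerivAt (0 : ℝ) h1).const_mul _)
  -- The path `s ↦ exp (-s a) exp (s (a + ε c))` runs from `1` to the product of interest, with
  -- velocity `exp (-s a) (ε c) exp (s (a + ε c))`. Replacing the last factor by `exp (s a)` puts
  -- the velocity in `𝔤`, where `φ` vanishes, at a cost of order `ε ^ 2`.
  have hquad : ∀ ε : ℝ, |ε| ≤ 1 →
      ‖φ (NormedSpace.exp (-a) * NormedSpace.exp (a + ε • c)) - φ 1‖ ≤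
        (‖φ‖ * (M * ‖c‖ * (K * ‖c‖))) * ‖ε‖ ^ 2 := by
    intro ε hε
    have hd : ∀ s : ℝ, HasDerivAt
        (fun s : ℝ => φ (NormedSpace.exp (-(s • a)) * NormedSpace.exp (s • (a + ε • c))))
        (φ (NormedSpace.exp (-(s • a)) * (ε • c) * NormedSpace.exp (s • (a + ε • c)))) s := by
      intro s
      have h1 := hasDerivAt_exp_neg_smul a s
      have h2 := hasDerivAt_exp_smul_const' (𝕂 := ℝ) (a + ε • c) s
      have h3 := φ.hasFDerivAt.comp_hasDerivAt s (h1.mul h2)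
      refine h3.congr_deriv ?_
      congr 1
      noncomm_ring
    have hb : ∀ s ∈ Ico (0 : ℝ) 1,
        ‖φ (NormedSpace.exp (-(s • a)) * (ε • c) * NormedSpace.exp (s • (a + ε • c)))‖ ≤
          (‖φ‖ * (M * ‖c‖ * (K * ‖c‖))) * ‖ε‖ ^ 2 := by
      intro s hs
      have hs1 : |s| ≤ 1 := abs_le.2 ⟨by linarith [hs.1], hs.2.le⟩
      have hsa : ‖s • a‖ ≤ R := by
        rw [norm_smul, Real.norm_eq_abs]
        calc |s| * ‖a‖ ≤ 1 * ‖a‖ := by gcongr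
          _ ≤ R := by rw [one_mul]; exact le_add_of_nonneg_right (norm_nonneg _)
      have hsb : ‖s • (a + ε • c)‖ ≤ R := by
        rw [norm_smul, Real.norm_eq_abs]
        calc |s| * ‖a + ε • c‖ ≤ 1 * (‖a‖ + ‖ε • c‖) := by gcongr; exact norm_add_le _ _
          _ ≤ R := by
            rw [one_mul, norm_smul, Real.norm_eq_abs]
            refine add_le_add_right ?_ _
            exact mul_le_of_le_one_left (norm_nonneg _) hε
      have h0 : φ (NormedSpace.exp (-(s • a)) * (ε • c) * NormedSpace.exp (s • a)) = 0 :=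
        hφ𝔤 _ (hAd _ (𝔤.smul_mem s ha) _ (𝔤.smul_mem ε hc))
      rw [← sub_zero (φ _), ← h0, ← map_sub, ← mul_sub]
      have hL := hK.dist_le_mul (s • (a + ε • c)) (by simpa using hsb) (s • a) (by simpa using hsa)
      rw [dist_eq_norm, dist_eq_norm, ← smul_sub, add_sub_cancel_left, norm_smul, norm_smul,
        Real.norm_eq_abs s] at hL
      have hL' : ‖NormedSpace.exp (s • (a + ε • c)) - NormedSpace.exp (s • a)‖ ≤
          K * (‖ε‖ * ‖c‖) := hL.trans
            (mul_le_mul_of_nonneg_left (mul_le_of_le_one_left (by positivity) hs1) K.2)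
      calc _ ≤ ‖φ‖ * ‖_‖ := φ.le_opNorm _
        _ ≤ ‖φ‖ * ((M * (‖ε‖ * ‖c‖)) * (K * (‖ε‖ * ‖c‖))) := by
          gcongr
          refine (norm_mul_le _ _).trans ?_
          gcongr
          refine (norm_mul_le _ _).trans ?_
          rw [norm_smul]
          gcongr
          exact hM _ (by rwa [norm_neg])
        _ = _ := by ring
    have := norm_image_sub_le_of_norm_deriv_le_segment_01' (fun s _ => (hd s).hasDerivWithinAt) hb
    simpa using this
  have hzero : HasDerivAt
      (fun ε : ℝ => φ (NormedSpace.exp (-a) * NormedSpace.exp (a + ε • c)) - φ 1) 0 0 := by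
    have hO : (fun ε : ℝ => φ (NormedSpace.exp (-a) * NormedSpace.exp (a + ε • c)) - φ 1)
        =O[𝓝 0] fun ε : ℝ => ‖ε - 0‖ ^ 2 := by
      refine Asymptotics.IsBigO.of_bound (‖φ‖ * (M * ‖c‖ * (K * ‖c‖))) ?_
      filter_upwards [Metric.closedBall_mem_nhds (0 : ℝ) one_pos] with ε hε
      rw [sub_zero, norm_pow, norm_norm]
      exact hquad ε (by simpa using hε)
    have := hO.hasFDerivAt (𝕜 := ℝ) one_lt_two
    exact this.hasDerivAt
  -- The quadratic bound makes the derivative in `ε` at `0` vanish, but that derivative is the value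
  -- of `φ` assumed nonzero.
  exact hφx ((hderiv.sub_const _).unique hzero)

end Exponential
end

/-! ### A local logarithm for a subspace stable under conjugation by its exponentials -/

noncomputable section
open Filter Topology Set

section LocalLog

variable {E 𝔸 : Type*} [NormedAddCommGroup E] [NormedSpace ℝ E] [FiniteDimensional ℝ E]
  [NormedRing 𝔸] [NormedAlgebra ℝ 𝔸] [FiniteDimensional ℝ 𝔸]

/-- Near the origin, left translates of the subspace `range j` are tangent to `exp ∘ j`, provided
`range j` is invariant under conjugation by the exponentials of its elements. -/
theorem eventually_exp_mul_mem_range_fderiv {j : E →L[ℝ] 𝔸} (hj : Function.Injective j)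
    (hAd : ∀ X Y : E, ∃ Z : E, NormedSpace.exp (j X) * j Y * NormedSpace.exp (-(j X)) = j Z) :
    ∀ᶠ u in 𝓝 (0 : E), ∀ Y : E, NormedSpace.exp (j u) * j Y ∈
      LinearMap.range (fderiv ℝ (fun v => NormedSpace.exp (j v)) u).toLinearMap := by
  have hf : ContDiff ℝ 1 (fun v => NormedSpace.exp (j v)) :=
    contDiff_exp_of_finiteDimensional.comp j.contDiff
  have hd : ∀ u, fderiv ℝ (fun v => NormedSpace.exp (j v)) u =
      (fderiv ℝ NormedSpace.exp (j u)).comp j := by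
    intro u
    have h1 : HasFDerivAt (NormedSpace.exp : 𝔸 → 𝔸) (fderiv ℝ NormedSpace.exp (j u)) (j u) :=
      (contDiff_exp_of_finiteDimensional.differentiable one_ne_zero (j u)).hasFDerivAt
    exact (h1.comp u j.hasFDerivAt).fderiv
  have hd0 : fderiv ℝ (fun v => NormedSpace.exp (j v)) 0 = j := by
    have : CompleteSpace 𝔸 := FiniteDimensional.complete ℝ 𝔸
    rw [hd, map_zero, (hasFDerivAt_exp_zero (𝕂 := ℝ) (𝔸 := 𝔸)).fderiv]
    rfl
  have hinj : ∀ᶠ u in 𝓝 (0 : E),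
      Function.Injective (fderiv ℝ (fun v => NormedSpace.exp (j v)) u) := by
    have hc : ContinuousAt (fderiv ℝ (fun v => NormedSpace.exp (j v))) 0 :=
      (hf.continuous_fderiv one_ne_zero).continuousAt
    exact hc.eventually (ContinuousLinearMap.isOpen_injective.mem_nhds (by
      change Function.Injective _; rw [hd0]; exact hj))
  filter_upwards [hinj] with u hu Y
  let T : E →ₗ[ℝ] 𝔸 := (LinearMap.mulLeft ℝ (NormedSpace.exp (-(j u)))).comp
    (fderiv ℝ (fun v => NormedSpace.exp (j v)) u).toLinearMap
  have hT : ∀ W, T W = NormedSpace.exp (-(j u)) *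
    fderiv ℝ (fun v => NormedSpace.exp (j v)) u W := fun W => rfl
  have hT' : ∀ W, NormedSpace.exp (j u) * T W =
      fderiv ℝ (fun v => NormedSpace.exp (j v)) u W := fun W => by
    rw [hT, ← mul_assoc, exp_mul_exp_neg, one_mul]
  have hTinj : Function.Injective T := fun a b hab => hu (by rw [← hT', ← hT', hab])
  have hle : LinearMap.range T ≤ LinearMap.range j.toLinearMap := by
    rintro _ ⟨W, rfl⟩
    rw [hT, hd]
    refine exp_neg_mul_fderiv_exp_mem ?_ ⟨u, rfl⟩ ⟨W, rfl⟩
    rintro _ ⟨X, rfl⟩ _ ⟨Y, rfl⟩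
    obtain ⟨Z, hZ⟩ := hAd (-X) Y
    refine ⟨Z, hZ.symm.trans ?_⟩
    simp
  -- The logarithmic derivative maps injectively into `range j`; equality of dimensions makes it
  -- onto.
  have heq : LinearMap.range T = LinearMap.range j.toLinearMap := by
    refine Submodule.eq_of_le_of_finrank_eq hle ?_
    rw [LinearMap.finrank_range_of_inj hTinj, LinearMap.finrank_range_of_inj hj]
  obtain ⟨W, hW⟩ : j Y ∈ LinearMap.range T := heq ▸ ⟨Y, rfl⟩
  exact ⟨W, by rw [← hW, hT']; rfl⟩

/-- Existence of a local logarithm with values in a subspace which is invariant under conjugation by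
the exponentials of its elements. -/
theorem exists_local_log {j : E →L[ℝ] 𝔸} (hj : Function.Injective j)
    (hAd : ∀ X Y : E, ∃ Z : E, NormedSpace.exp (j X) * j Y * NormedSpace.exp (-(j X)) = j Z) :
    ∃ (r : 𝔸 → E) (ε : ℝ), 0 < ε ∧
      (∀ Z, ‖Z‖ < ε → ContDiffAt ℝ ω r (NormedSpace.exp (j Z)) ∧ r (NormedSpace.exp (j Z)) = Z) ∧
      (∀ Z, ‖Z‖ < ε → ∀ᶠ p : E × E in 𝓝 (Z, 0),
        NormedSpace.exp (j (r (NormedSpace.exp (j p.1) * NormedSpace.exp (j p.2)))) =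
          NormedSpace.exp (j p.1) * NormedSpace.exp (j p.2)) ∧
      ∀ Z Z', ‖Z‖ < ε → ‖Z'‖ < ε →
        NormedSpace.exp (j (r (NormedSpace.exp (j Z) * NormedSpace.exp (j Z')))) =
          NormedSpace.exp (j Z) * NormedSpace.exp (j Z') := by
  have : CompleteSpace 𝔸 := FiniteDimensional.complete ℝ 𝔸
  have hf : ContDiff ℝ ω (fun v => NormedSpace.exp (j v)) :=
    contDiff_exp_of_finiteDimensional.comp j.contDiff
  have hd0 : fderiv ℝ (fun v => NormedSpace.exp (j v)) 0 = j := by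
    have h1 : HasFDerivAt (NormedSpace.exp : 𝔸 → 𝔸) (1 : 𝔸 →L[ℝ] 𝔸) (j 0) := by
      rw [map_zero]; exact hasFDerivAt_exp_zero
    exact (h1.comp (0 : E) j.hasFDerivAt).fderiv
  have hf0 : NormedSpace.exp (j 0) = (1 : 𝔸) := by rw [map_zero, NormedSpace.exp_zero]
  obtain ⟨r, B, hr, hleft, hB, hcurve⟩ := exists_leftInverse_of_immersion (n := ω) le_top
    (u₀ := 0) hf.contDiffAt (by rw [hd0]; exact hj) (eventually_exp_mul_mem_range_fderiv hj hAd)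
  rw [hf0] at hr hB
  have hfc : Continuous fun v => NormedSpace.exp (j v) := hf.continuous
  -- it suffices to have `exp Z exp (tY)` in `B`
  have key : ∀ Z Y : E, r (NormedSpace.exp (j Z)) = Z →
      (∀ t ∈ Icc (0 : ℝ) 1, NormedSpace.exp (j Z) * NormedSpace.exp (j (t • Y)) ∈ B) →
      NormedSpace.exp (j (r (NormedSpace.exp (j Z) * NormedSpace.exp (j Y)))) =
        NormedSpace.exp (j Z) * NormedSpace.exp (j Y) := by
    intro Z Y hZ hYB
    -- The curve `t ↦ exp Z * exp (t Y)` is an integral curve of right multiplication by `j Y`, a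
    -- linear field on the algebra tangent to the image of `exp ∘ j` near the identity.
    have h := hcurve ((ContinuousLinearMap.mul ℝ 𝔸).flip (j Y)) (fun u hu => hu Y)
      (fun t => NormedSpace.exp (j Z) * NormedSpace.exp (j (t • Y))) (fun t _ => by
        have := (hasDerivAt_exp_smul_const (𝕂 := ℝ) (j Y) t).const_mul (NormedSpace.exp (j Z))
        simpa [mul_assoc] using this) hYB (by simp [NormedSpace.exp_zero, hZ])
    simpa using h
  obtain ⟨B', hB'B, hB'o, h1B'⟩ := mem_nhds_iff.1 hB
  have hev : ∀ᶠ Z in 𝓝 (0 : E), NormedSpace.exp (j Z) ∈ B' ∧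
      ContDiffAt ℝ ω r (NormedSpace.exp (j Z)) ∧ r (NormedSpace.exp (j Z)) = Z := by
    have ht : Tendsto (fun v => NormedSpace.exp (j v)) (𝓝 0) (𝓝 1) := by
      have := hfc.tendsto 0
      rwa [hf0] at this
    filter_upwards [ht (hB'o.mem_nhds h1B'), ht.eventually (hr.eventually (by simp)), hleft]
      with Z h1 h2 h3 using ⟨h1, h2, h3⟩
  obtain ⟨ε₁, hε₁, hball⟩ := Metric.eventually_nhds_iff_ball.1 hev
  have hmul : ∀ Z, ‖Z‖ < ε₁ → ∀ᶠ p : E × E in 𝓝 (Z, 0),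
        NormedSpace.exp (j (r (NormedSpace.exp (j p.1) * NormedSpace.exp (j p.2)))) =
          NormedSpace.exp (j p.1) * NormedSpace.exp (j p.2) := by
    intro Z hZ
    have hc : Tendsto (fun p : E × E => NormedSpace.exp (j p.1) * NormedSpace.exp (j p.2))
        (𝓝 (Z, 0)) (𝓝 (NormedSpace.exp (j Z))) := by
      have hcont : Continuous fun p : E × E =>
          NormedSpace.exp (j p.1) * NormedSpace.exp (j p.2) :=
        (hfc.comp continuous_fst).mul (hfc.comp continuous_snd)
      simpa [NormedSpace.exp_zero] using hcont.tendsto (Z, 0)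
    have hmem := hc (hB'o.mem_nhds (hball Z (by simpa using hZ)).1)
    rw [mem_map, nhds_prod_eq] at hmem
    obtain ⟨s, hs, t, ht, hst⟩ := Filter.mem_prod_iff.1 hmem
    -- The second factor is shrunk to a ball so that all of `τ • p.2`, `τ ∈ [0, 1]`, stays in it.
    obtain ⟨δ, hδ, hδt⟩ := Metric.mem_nhds_iff.1 ht
    rw [nhds_prod_eq]
    filter_upwards [prod_mem_prod (inter_mem hs (Metric.isOpen_ball.mem_nhds
      (show Z ∈ Metric.ball 0 ε₁ by simpa using hZ))) (Metric.ball_mem_nhds (0 : E) hδ)]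
      with p hp
    refine key p.1 p.2 (hball p.1 hp.1.2).2.2 fun τ hτ => hB'B ?_
    refine hst (mk_mem_prod hp.1.1 (hδt ?_) : (p.1, τ • p.2) ∈ s ×ˢ t)
    have h2 := hp.2
    simp only [Metric.mem_ball, dist_zero_right, norm_smul, Real.norm_eq_abs] at h2 ⊢
    refine lt_of_le_of_lt (mul_le_of_le_one_left (norm_nonneg _) ?_) h2
    exact abs_le.2 ⟨by linarith [hτ.1], hτ.2⟩
  obtain ⟨ε₂, hε₂, hball₂⟩ := Metric.eventually_nhds_iff_ball.1 (hmul 0 (by simpa using hε₁))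
  refine ⟨r, min ε₁ ε₂, lt_min hε₁ hε₂, fun Z hZ =>
    (hball Z (by simpa using hZ.trans_le (min_le_left _ _))).2, fun Z hZ =>
    hmul Z (hZ.trans_le (min_le_left _ _)), fun Z Z' hZ hZ' => hball₂ (Z, Z') ?_⟩
  rw [Metric.mem_ball, Prod.dist_eq, max_lt_iff]
  simpa using ⟨hZ.trans_le (min_le_right _ _), hZ'.trans_le (min_le_right _ _)⟩

end LocalLog
end

/-! ### The Lie group generated by the exponentials -/

noncomputable section
open Filter Topology Set

/-- A finite-dimensional subspace of an algebra, parametrized by an injective linear map `E → 𝔸`,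
which is invariant under conjugation by the exponentials of its elements. -/
structure IntegrableSubspace (E 𝔸 : Type*) [NormedAddCommGroup E] [NormedSpace ℝ E]
    [NormedRing 𝔸] [NormedAlgebra ℝ 𝔸] where
  toCLM : E →L[ℝ] 𝔸
  injective : Function.Injective toCLM
  conj_mem : ∀ X Y : E, ∃ Z : E,
    NormedSpace.exp (toCLM X) * toCLM Y * NormedSpace.exp (-(toCLM X)) = toCLM Z

set_option linter.unusedSectionVars false

namespace IntegrableSubspace

variable {E 𝔸 : Type*} [NormedAddCommGroup E] [NormedSpace ℝ E] [FiniteDimensional ℝ E]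
  [NormedRing 𝔸] [NormedAlgebra ℝ 𝔸] [FiniteDimensional ℝ 𝔸] (D : IntegrableSubspace E 𝔸)

/-- The exponential of an element of the subspace, as a unit. -/
def expUnit (X : E) : 𝔸ˣ where
  val := NormedSpace.exp (D.toCLM X)
  inv := NormedSpace.exp (-(D.toCLM X))
  val_inv := exp_mul_exp_neg _
  inv_val := exp_neg_mul_exp _

/-- The group generated by the exponentials of the elements of the subspace. It carries a topology
that may be finer than the subspace topology. -/
def Grp : Type _ := Subgroup.closure (range D.expUnit)

instance : Group D.Grp := inferInstanceAs (Group (Subgroup.closure (range D.expUnit)))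

/-- The inclusion into the group of units. -/
def incl : D.Grp →* 𝔸ˣ := Subgroup.subtype (Subgroup.closure (range D.expUnit))

/-- An element of the group as an element of the algebra. -/
def val (g : D.Grp) : 𝔸 := (D.incl g : 𝔸)

/-- The exponential map to the group. -/
def exp (X : E) : D.Grp := ⟨D.expUnit X, Subgroup.subset_closure ⟨X, rfl⟩⟩

@[simp] theorem val_exp (X : E) : D.val (D.exp X) = NormedSpace.exp (D.toCLM X) := rfl

@[simp] theorem val_mul (g h : D.Grp) : D.val (g * h) = D.val g * D.val h := rfl

@[simp] theorem val_one : D.val 1 = 1 := rfl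

theorem val_injective : Function.Injective D.val := fun _ _ h => Subtype.ext (Units.ext h)

theorem val_mul_val_inv (g : D.Grp) : D.val g * D.val g⁻¹ = 1 := by
  rw [← val_mul, mul_inv_cancel, val_one]

theorem val_inv_mul_val (g : D.Grp) : D.val g⁻¹ * D.val g = 1 := by
  rw [← val_mul, inv_mul_cancel, val_one]

theorem exp_zero : D.exp 0 = 1 := D.val_injective (by simp [NormedSpace.exp_zero])

theorem exp_neg (X : E) : D.exp (-X) = (D.exp X)⁻¹ := by
  rw [eq_inv_iff_mul_eq_one]
  exact D.val_injective (by simp [exp_neg_mul_exp])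

theorem exp_nsmul (n : ℕ) (X : E) : D.exp (n • X) = D.exp X ^ n := by
  have : CompleteSpace 𝔸 := FiniteDimensional.complete ℝ 𝔸
  let _ := NormedAlgebra.restrictScalars ℚ ℝ 𝔸
  refine D.val_injective ?_
  change NormedSpace.exp (D.toCLM (n • X)) = NormedSpace.exp (D.toCLM X) ^ n
  rw [map_nsmul, NormedSpace.exp_nsmul]

/-- Induction principle for the group: it is generated by exponentials. -/
theorem grp_induction {p : D.Grp → Prop} (h1 : p 1) (hexp : ∀ X g, p g → p (D.exp X * g))
    (g : D.Grp) : p g := by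
  obtain ⟨g, hg⟩ := g
  induction hg using Subgroup.closure_induction_left with
  | one => exact h1
  | mul_left x hx y hy ih =>
    obtain ⟨X, rfl⟩ := hx
    exact hexp X ⟨y, hy⟩ ih
  | inv_mul_cancel x hx y hy ih =>
    obtain ⟨X, rfl⟩ := hx
    have := hexp (-X) ⟨y, hy⟩ ih
    rwa [exp_neg] at this

/-- Stability under conjugation passes from single exponentials to the products that make up the
group. -/
theorem exists_conj_eq (g : D.Grp) (Y : E) :
    ∃ Z, D.val g * D.toCLM Y * D.val g⁻¹ = D.toCLM Z := by
  induction g using D.grp_induction generalizing Y with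
  | h1 => exact ⟨Y, by simp⟩
  | hexp X g ih =>
    obtain ⟨Z, hZ⟩ := ih Y
    obtain ⟨W, hW⟩ := D.conj_mem X Z
    refine ⟨W, ?_⟩
    rw [mul_inv_rev, ← exp_neg, ← hW, ← hZ]
    simp [mul_assoc]

theorem exists_continuous_leftInverse : ∃ π : 𝔸 →L[ℝ] E, ∀ X, π (D.toCLM X) = X := by
  obtain ⟨π, hπ⟩ := D.toCLM.toLinearMap.exists_leftInverse_of_injective
    (LinearMap.ker_eq_bot.2 D.injective)
  exact ⟨LinearMap.toContinuousLinearMap π, fun X => LinearMap.congr_fun hπ X⟩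

/-- Conjugation by an element of the group maps small exponentials to small exponentials. -/
theorem exists_conj_exp (g : D.Grp) {ε : ℝ} (hε : 0 < ε) :
    ∃ δ > 0, ∀ X, ‖X‖ < δ → ∃ Z, ‖Z‖ < ε ∧ g * D.exp X * g⁻¹ = D.exp Z := by
  have : CompleteSpace 𝔸 := FiniteDimensional.complete ℝ 𝔸
  obtain ⟨π, hπ⟩ := D.exists_continuous_leftInverse
  have hc : Continuous fun X => π (D.val g * D.toCLM X * D.val g⁻¹) := by fun_prop
  have ht := hc.tendsto 0
  simp only [map_zero, mul_zero, zero_mul] at ht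
  obtain ⟨δ, hδ, h⟩ := Metric.eventually_nhds_iff_ball.1 (ht (Metric.ball_mem_nhds 0 hε))
  refine ⟨δ, hδ, fun X hX => ?_⟩
  obtain ⟨Z, hZ⟩ := D.exists_conj_eq g X
  have h2 := h X (by simpa using hX)
  simp only [hZ, hπ] at h2
  refine ⟨Z, by simpa using h2, D.val_injective ?_⟩
  let _ := NormedAlgebra.restrictScalars ℚ ℝ 𝔸
  have := NormedSpace.exp_units_conj (D.incl g) (D.toCLM X)
  rw [val_exp, ← hZ]
  exact this.symm

/-- A local logarithm, see `exists_local_log`. -/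
def log : 𝔸 → E := (exists_local_log D.injective D.conj_mem).choose

/-- A radius for the local logarithm. -/
def radius : ℝ := (exists_local_log D.injective D.conj_mem).choose_spec.choose

theorem radius_pos : 0 < D.radius :=
  (exists_local_log D.injective D.conj_mem).choose_spec.choose_spec.1

theorem contDiffAt_log {Z : E} (hZ : ‖Z‖ < D.radius) :
    ContDiffAt ℝ ω D.log (D.val (D.exp Z)) :=
  ((exists_local_log D.injective D.conj_mem).choose_spec.choose_spec.2.1 Z hZ).1

theorem log_exp {Z : E} (hZ : ‖Z‖ < D.radius) : D.log (D.val (D.exp Z)) = Z :=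
  ((exists_local_log D.injective D.conj_mem).choose_spec.choose_spec.2.1 Z hZ).2

theorem eventually_exp_log_mul {Z : E} (hZ : ‖Z‖ < D.radius) : ∀ᶠ p : E × E in 𝓝 (Z, 0),
    D.exp (D.log (D.val (D.exp p.1 * D.exp p.2))) = D.exp p.1 * D.exp p.2 := by
  filter_upwards
    [(exists_local_log D.injective D.conj_mem).choose_spec.choose_spec.2.2.1 Z hZ] with p hp
  exact D.val_injective hp

theorem exp_log_mul {Z Z' : E} (hZ : ‖Z‖ < D.radius) (hZ' : ‖Z'‖ < D.radius) :
    D.exp (D.log (D.val (D.exp Z * D.exp Z'))) = D.exp Z * D.exp Z' :=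
  D.val_injective
    ((exists_local_log D.injective D.conj_mem).choose_spec.choose_spec.2.2.2 Z Z' hZ hZ')

theorem contDiff_val_exp : ContDiff ℝ ω fun X => D.val (D.exp X) :=
  contDiff_exp_of_finiteDimensional.comp D.toCLM.contDiff

theorem continuous_val_exp : Continuous fun X => D.val (D.exp X) := D.contDiff_val_exp.continuous

theorem tendsto_log_mul {Z : E} (hZ : ‖Z‖ < D.radius) :
    Tendsto (fun p : E × E => D.log (D.val (D.exp p.1 * D.exp p.2))) (𝓝 (Z, 0)) (𝓝 Z) := by
  have h1 : Tendsto (fun p : E × E => D.val (D.exp p.1 * D.exp p.2)) (𝓝 (Z, 0))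
      (𝓝 (D.val (D.exp Z))) := by
    have hc : Continuous fun p : E × E => D.val (D.exp p.1 * D.exp p.2) :=
      (D.continuous_val_exp.comp continuous_fst).mul (D.continuous_val_exp.comp continuous_snd)
    simpa only [exp_zero, mul_one] using hc.tendsto (Z, 0)
  have h2 := (D.contDiffAt_log hZ).continuousAt.tendsto
  rw [D.log_exp hZ] at h2
  exact h2.comp h1

theorem exists_exp_mul_exp {ε : ℝ} (hε : 0 < ε) : ∃ δ > 0, ∀ X Y, ‖X‖ < δ → ‖Y‖ < δ →
    ∃ Z, ‖Z‖ < ε ∧ D.exp X * D.exp Y = D.exp Z := by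
  have h0 : ‖(0 : E)‖ < D.radius := by simpa using D.radius_pos
  obtain ⟨δ, hδ, h⟩ := Metric.eventually_nhds_iff_ball.1
    ((D.eventually_exp_log_mul h0).and ((D.tendsto_log_mul h0) (Metric.ball_mem_nhds 0 hε)))
  refine ⟨δ, hδ, fun X Y hX hY => ?_⟩
  obtain ⟨h1, h2⟩ := h (X, Y) (by
    rw [Metric.mem_ball, Prod.dist_eq, max_lt_iff]; simpa using ⟨hX, hY⟩)
  exact ⟨_, by simpa using h2, h1.symm⟩

/-- The exponentials of small elements form a neighbourhood basis of the identity. -/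
@[reducible] def filterBasis : GroupFilterBasis D.Grp where
  sets := {U | ∃ ε > 0, U = D.exp '' Metric.ball 0 ε}
  nonempty := ⟨_, 1, one_pos, rfl⟩
  inter_sets := by
    rintro _ _ ⟨ε, hε, rfl⟩ ⟨δ, hδ, rfl⟩
    exact ⟨_, ⟨min ε δ, lt_min hε hδ, rfl⟩, subset_inter
      (image_mono (Metric.ball_subset_ball (min_le_left _ _)))
      (image_mono (Metric.ball_subset_ball (min_le_right _ _)))⟩
  one' := by
    rintro _ ⟨ε, hε, rfl⟩
    exact ⟨0, Metric.mem_ball_self hε, D.exp_zero⟩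
  mul' := by
    rintro _ ⟨ε, hε, rfl⟩
    obtain ⟨δ, hδ, h⟩ := D.exists_exp_mul_exp hε
    refine ⟨_, ⟨δ, hδ, rfl⟩, ?_⟩
    rintro _ ⟨_, ⟨X, hX, rfl⟩, _, ⟨Y, hY, rfl⟩, rfl⟩
    obtain ⟨Z, hZ, h2⟩ := h X Y (by simpa using hX) (by simpa using hY)
    exact ⟨Z, by simpa using hZ, h2.symm⟩
  inv' := by
    rintro _ ⟨ε, hε, rfl⟩
    refine ⟨_, ⟨ε, hε, rfl⟩, ?_⟩
    rintro _ ⟨X, hX, rfl⟩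
    exact ⟨-X, by simpa using hX, D.exp_neg X⟩
  conj' := by
    rintro g _ ⟨ε, hε, rfl⟩
    obtain ⟨δ, hδ, h⟩ := D.exists_conj_exp g hε
    refine ⟨_, ⟨δ, hδ, rfl⟩, ?_⟩
    rintro _ ⟨X, hX, rfl⟩
    obtain ⟨Z, hZ, h2⟩ := h X (by simpa using hX)
    exact ⟨Z, by simpa using hZ, h2.symm⟩

instance : TopologicalSpace D.Grp := D.filterBasis.topology

instance : IsTopologicalGroup D.Grp := D.filterBasis.isTopologicalGroup

theorem nhds_one_hasBasis :
    (𝓝 (1 : D.Grp)).HasBasis (fun ε : ℝ => 0 < ε) fun ε => D.exp '' Metric.ball 0 ε := by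
  refine D.filterBasis.nhds_one_hasBasis.to_hasBasis ?_ ?_
  · rintro _ ⟨ε, hε, rfl⟩
    exact ⟨ε, hε, subset_rfl⟩
  · intro ε hε
    exact ⟨_, ⟨ε, hε, rfl⟩, subset_rfl⟩

theorem nhds_one_eq_map : 𝓝 (1 : D.Grp) = map D.exp (𝓝 0) :=
  D.nhds_one_hasBasis.eq_of_same_basis (Metric.nhds_basis_ball.map D.exp)

theorem nhds_eq_map_left (g : D.Grp) : 𝓝 g = map (fun X => g * D.exp X) (𝓝 0) := by
  rw [← map_mul_left_nhds_one g, nhds_one_eq_map, map_map]; rfl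

theorem nhds_eq_map_right (g : D.Grp) : 𝓝 g = map (fun X => D.exp X * g) (𝓝 0) := by
  rw [← map_mul_right_nhds_one g, nhds_one_eq_map, map_map]; rfl

variable {D} in
theorem mem_nhds_iff {g : D.Grp} {s : Set D.Grp} :
    s ∈ 𝓝 g ↔ ∀ᶠ X in 𝓝 (0 : E), D.exp X * g ∈ s := by
  rw [nhds_eq_map_right]; rfl

theorem continuous_val : Continuous D.val := by
  have : CompleteSpace 𝔸 := FiniteDimensional.complete ℝ 𝔸
  refine continuous_iff_continuousAt.2 fun g => ?_
  rw [ContinuousAt, nhds_eq_map_left, tendsto_map'_iff]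
  have hc : Continuous fun X => D.val g * D.val (D.exp X) :=
    continuous_const.mul D.continuous_val_exp
  have h := hc.tendsto 0
  simp only [exp_zero, val_one, mul_one] at h
  exact h

/-- Continuity in the finer topology of the group is not inherited from the algebra. For `Z'` near
`Z` one writes `exp Z' = exp Z * exp (log (exp (-Z) * exp Z'))`, and the logarithm tends to `0`. -/
theorem continuousAt_exp {Z : E} (hZ : ‖Z‖ < D.radius) : ContinuousAt D.exp Z := by
  have h1 : Tendsto (fun Z' => D.log (D.val (D.exp (-Z) * D.exp Z'))) (𝓝 Z) (𝓝 0) := by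
    have hc : Continuous fun Z' => D.val (D.exp (-Z) * D.exp Z') :=
      continuous_const.mul D.continuous_val_exp
    have h0 : ‖(0 : E)‖ < D.radius := by simpa using D.radius_pos
    have h2 := (D.contDiffAt_log h0).continuousAt.tendsto
    rw [D.log_exp h0] at h2
    refine h2.comp ?_
    have := hc.tendsto Z
    rw [exp_neg, inv_mul_cancel, ← exp_zero] at this
    simpa only [exp_neg] using this
  rw [ContinuousAt, nhds_eq_map_left (D := D) (D.exp Z)]
  have h3 : Tendsto (fun Z' => D.exp Z * D.exp (D.log (D.val (D.exp (-Z) * D.exp Z'))))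
      (𝓝 Z) (map (fun X => D.exp Z * D.exp X) (𝓝 0)) := tendsto_map.comp h1
  refine h3.congr' ?_
  filter_upwards [Metric.isOpen_ball.mem_nhds (show Z ∈ Metric.ball 0 D.radius by simpa using hZ)]
    with Z' hZ'
  rw [D.exp_log_mul (by simpa using hZ) (by simpa using hZ'), exp_neg, mul_inv_cancel_left]

/-- For small `Y` the product `exp Z * exp Y` is the exponential of its logarithm, which is close to
`Z` and so still in the ball. -/
theorem isOpen_exp_ball : IsOpen (D.exp '' Metric.ball 0 D.radius) := by
  rw [isOpen_iff_mem_nhds]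
  rintro _ ⟨Z, hZ, rfl⟩
  have hZ' : ‖Z‖ < D.radius := by simpa using hZ
  rw [nhds_eq_map_left, mem_map]
  have ht : Tendsto (fun Y : E => (Z, Y)) (𝓝 0) (𝓝 (Z, 0)) :=
    (Continuous.prodMk_right Z).tendsto 0
  filter_upwards [ht.eventually (D.eventually_exp_log_mul hZ'),
    ht.eventually ((D.tendsto_log_mul hZ') (Metric.isOpen_ball.mem_nhds hZ))] with Y h1 h2
  exact ⟨_, h2, h1⟩

/-- The logarithm chart at the identity. -/
def chartOne : OpenPartialHomeomorph D.Grp E where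
  toFun g := D.log (D.val g)
  invFun := D.exp
  source := D.exp '' Metric.ball 0 D.radius
  target := Metric.ball 0 D.radius
  map_source' := by
    rintro _ ⟨Z, hZ, rfl⟩
    rwa [D.log_exp (by simpa using hZ)]
  map_target' Z hZ := ⟨Z, hZ, rfl⟩
  left_inv' := by
    rintro _ ⟨Z, hZ, rfl⟩
    rw [D.log_exp (by simpa using hZ)]
  right_inv' Z hZ := D.log_exp (by simpa using hZ)
  open_source := D.isOpen_exp_ball
  open_target := Metric.isOpen_ball
  continuousOn_toFun := by
    rintro _ ⟨Z, hZ, rfl⟩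
    exact ((D.contDiffAt_log (by simpa using hZ)).continuousAt.comp
      D.continuous_val.continuousAt).continuousWithinAt
  continuousOn_invFun Z hZ := (D.continuousAt_exp (by simpa using hZ)).continuousWithinAt

/-- The left-translated logarithm chart. -/
def chart (g : D.Grp) : OpenPartialHomeomorph D.Grp E :=
  (Homeomorph.mulLeft g⁻¹).transOpenPartialHomeomorph D.chartOne

theorem chart_apply (g h : D.Grp) : D.chart g h = D.log (D.val g⁻¹ * D.val h) := rfl

theorem chart_symm_apply (g : D.Grp) (X : E) : (D.chart g).symm X = g * D.exp X := by
  change (Homeomorph.mulLeft g⁻¹).symm (D.exp X) = _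
  rw [Homeomorph.mulLeft_symm, inv_inv]
  rfl

theorem chart_self (g : D.Grp) : D.chart g g = 0 := by
  rw [chart_apply, val_inv_mul_val, ← D.val_one, ← D.exp_zero,
    D.log_exp (by rw [norm_zero]; exact D.radius_pos)]

theorem mem_chart_source {g h : D.Grp} :
    h ∈ (D.chart g).source ↔ ∃ Z, ‖Z‖ < D.radius ∧ h = g * D.exp Z := by
  change g⁻¹ * h ∈ D.exp '' Metric.ball 0 D.radius ↔ _
  simp only [mem_image, Metric.mem_ball, dist_zero_right]
  exact exists_congr fun Z => and_congr_right fun _ => by rw [eq_inv_mul_iff_mul_eq, eq_comm]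

theorem self_mem_chart_source (g : D.Grp) : g ∈ (D.chart g).source :=
  D.mem_chart_source.2 ⟨0, by simpa using D.radius_pos, by rw [exp_zero, mul_one]⟩

instance : ChartedSpace E D.Grp where
  atlas := range D.chart
  chartAt := D.chart
  mem_chart_source := D.self_mem_chart_source
  chart_mem_atlas g := ⟨g, rfl⟩

/-- `log` is smooth on open sets of the ambient algebra, not only along the group. Smoothness of
chart changes and of maps into the group thereby reduces to calculus in `𝔸`. -/
theorem contDiffAt_log_mul {g h : D.Grp} (hh : h ∈ (D.chart g).source) :
    ContDiffAt ℝ ω (fun a => D.log (D.val g⁻¹ * a)) (D.val h) := by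
  have : CompleteSpace 𝔸 := FiniteDimensional.complete ℝ 𝔸
  obtain ⟨Z, hZ, rfl⟩ := D.mem_chart_source.1 hh
  have h1 : ContDiffAt ℝ ω D.log (D.val g⁻¹ * D.val (g * D.exp Z)) := by
    rw [val_mul, ← mul_assoc, val_inv_mul_val, one_mul]
    exact D.contDiffAt_log hZ
  exact ContDiffAt.comp (D.val (g * D.exp Z)) h1 (contDiff_const.mul contDiff_id).contDiffAt

instance : IsManifold 𝓘(ℝ, E) ∞ D.Grp := by
  have : CompleteSpace 𝔸 := FiniteDimensional.complete ℝ 𝔸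
  refine isManifold_of_contDiffOn _ _ _ ?_
  rintro _ _ ⟨g, rfl⟩ ⟨h, rfl⟩ X ⟨hX, -⟩
  have hX' : X ∈ (D.chart g).target ∧ (D.chart g).symm X ∈ (D.chart h).source := by
    simpa [OpenPartialHomeomorph.trans_source] using hX
  have h1 := D.contDiffAt_log_mul hX'.2
  rw [chart_symm_apply] at h1
  have h2 : ContDiffAt ℝ ω (fun X => D.val (g * D.exp X)) X :=
    (contDiff_const.mul D.contDiff_val_exp).contDiffAt
  have h3 := (h1.comp X h2).of_le (m := ∞) le_top
  refine (h3.congr_of_eventuallyEq (Eventually.of_forall fun Y => ?_)).contDiffWithinAt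
  simp [chart_apply, chart_symm_apply]

theorem contMDiff_val : ContMDiff 𝓘(ℝ, E) 𝓘(ℝ, 𝔸) ∞ D.val := by
  have : CompleteSpace 𝔸 := FiniteDimensional.complete ℝ 𝔸
  intro g
  have h2 : ContDiff ℝ ∞ (fun X => D.val (g * D.exp X)) :=
    (contDiff_const.mul D.contDiff_val_exp).of_le le_top
  have h3 : ContMDiffAt 𝓘(ℝ, E) 𝓘(ℝ, E) ∞ (extChartAt 𝓘(ℝ, E) g) g := contMDiffAt_extChartAt
  refine (h2.contMDiff.contMDiffAt.comp g h3).congr_of_eventuallyEq ?_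
  filter_upwards [(D.chart g).open_source.mem_nhds (D.self_mem_chart_source g)] with h hh
  have := (D.chart g).left_inv hh
  rw [chart_symm_apply] at this
  exact (congrArg D.val this).symm

/-- A continuous map to the group is smooth if it is smooth as a map to the algebra. -/
theorem contMDiff_of_val {E' H' M : Type*} [NormedAddCommGroup E'] [NormedSpace ℝ E']
    [TopologicalSpace H'] {I' : ModelWithCorners ℝ E' H'} [TopologicalSpace M]
    [ChartedSpace H' M] {f : M → D.Grp} (hf : Continuous f)
    (hf' : ContMDiff I' 𝓘(ℝ, 𝔸) ∞ fun x => D.val (f x)) : ContMDiff I' 𝓘(ℝ, E) ∞ f := by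
  intro x
  rw [contMDiffAt_iff_target]
  refine ⟨hf.continuousAt, ?_⟩
  have h1 := (D.contDiffAt_log_mul (D.self_mem_chart_source (f x))).of_le (m := ∞) le_top
  exact ContMDiffAt.comp (g := fun a => D.log (D.val (f x)⁻¹ * a)) x h1.contMDiffAt (hf' x)

instance : LieGroup 𝓘(ℝ, E) ∞ D.Grp where
  contMDiff_mul := by
    have : CompleteSpace 𝔸 := FiniteDimensional.complete ℝ 𝔸
    refine D.contMDiff_of_val continuous_mul ?_
    have hm : ContDiff ℝ ∞ fun p : 𝔸 × 𝔸 => p.1 * p.2 := contDiff_fst.mul contDiff_snd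
    exact hm.contMDiff.comp ((D.contMDiff_val.comp contMDiff_fst).prodMk_space
      (D.contMDiff_val.comp contMDiff_snd))
  contMDiff_inv := by
    have : CompleteSpace 𝔸 := FiniteDimensional.complete ℝ 𝔸
    refine D.contMDiff_of_val continuous_inv fun g => ?_
    have h1 : ContDiffAt ℝ ∞ Ring.inverse (D.val g) := contDiffAt_ringInverse ℝ (D.incl g)
    refine (h1.contMDiffAt.comp g (D.contMDiff_val g)).congr_of_eventuallyEq
      (Eventually.of_forall fun h => ?_)
    exact (Ring.inverse_unit (D.incl h)).symm

instance : ConnectedSpace D.Grp := by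
  have hball : D.exp '' Metric.ball 0 D.radius ⊆ Subgroup.connectedComponentOfOne D.Grp := by
    refine IsPreconnected.subset_connectedComponent ?_ ?_
    · exact (convex_ball (0 : E) D.radius).isPreconnected.image _
        fun Z hZ => (D.continuousAt_exp (by simpa using hZ)).continuousWithinAt
    · exact ⟨0, Metric.mem_ball_self D.radius_pos, D.exp_zero⟩
  have hexp : ∀ X, D.exp X ∈ Subgroup.connectedComponentOfOne D.Grp := by
    intro X
    obtain ⟨N, hN⟩ := exists_nat_gt (‖X‖ / D.radius)
    have hN0 : (0 : ℝ) < N := lt_of_le_of_lt (div_nonneg (norm_nonneg _) D.radius_pos.le) hN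
    -- Every exponential is a power of one from the small ball, which is connected and contains the
    -- identity.
    have h1 : D.exp X = D.exp ((N : ℝ)⁻¹ • X) ^ N := by
      rw [← exp_nsmul, ← Nat.cast_smul_eq_nsmul ℝ, smul_smul, mul_inv_cancel₀ hN0.ne', one_smul]
    rw [h1]
    refine pow_mem (hball ⟨_, ?_, rfl⟩) N
    rw [Metric.mem_ball, dist_zero_right, norm_smul, norm_inv, Real.norm_natCast,
      inv_mul_lt_iff₀ hN0]
    rwa [div_lt_iff₀ D.radius_pos] at hN
  have htop : ∀ g : D.Grp, g ∈ Subgroup.connectedComponentOfOne D.Grp := fun g => by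
    induction g using D.grp_induction with
    | h1 => exact one_mem _
    | hexp X g ih => exact mul_mem (hexp X) ih
  refine connectedSpace_iff_connectedComponent.2 ⟨1, eq_univ_of_forall htop⟩

/-- In the chart centred at `g` the inclusion reads `X ↦ val g * exp X`, whose derivative at `0` is
left translation of `toCLM`. -/
theorem mfderiv_val (g : D.Grp) (X : E) :
    mfderiv 𝓘(ℝ, E) 𝓘(ℝ, 𝔸) D.val g X = D.val g * D.toCLM X := by
  have : CompleteSpace 𝔸 := FiniteDimensional.complete ℝ 𝔸
  have hd : MDifferentiableAt 𝓘(ℝ, E) 𝓘(ℝ, 𝔸) D.val g :=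
    (D.contMDiff_val g).mdifferentiableAt (by simp)
  have h0 : extChartAt 𝓘(ℝ, E) g g = 0 := D.chart_self g
  have hw : writtenInExtChartAt 𝓘(ℝ, E) 𝓘(ℝ, 𝔸) g D.val = fun X => D.val g * D.val (D.exp X) := by
    ext X
    change D.val ((D.chart g).symm X) = _
    rw [chart_symm_apply, val_mul]
  rw [hd.mfderiv, h0, hw]
  have h1 : HasFDerivAt (fun X => D.val (D.exp X)) D.toCLM 0 := by
    have h2 : HasFDerivAt (NormedSpace.exp : 𝔸 → 𝔸) (1 : 𝔸 →L[ℝ] 𝔸) (D.toCLM 0) := by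
      rw [map_zero]; exact hasFDerivAt_exp_zero
    exact h2.comp (0 : E) D.toCLM.hasFDerivAt
  have h3 := (h1.const_mul (D.val g)).hasFDerivWithinAt (s := range 𝓘(ℝ, E))
  rw [h3.fderivWithin (𝓘(ℝ, E).uniqueDiffOn _ (mem_range_self _))]
  rfl

end IntegrableSubspace
end

/-! ### Infinitesimal invariance of the multivector field along the submanifold -/

noncomputable section
open Filter Topology Set

section FiniteDimensional

variable {V N : Type*} [NormedAddCommGroup V] [NormedSpace ℝ V] [FiniteDimensional ℝ V]
  [NormedAddCommGroup N] [NormedSpace ℝ N]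

/-- A multilinear map on a finite-dimensional space is continuous. -/
theorem MultilinearMap.continuous_of_finiteDimensional {ι : Type*} [Fintype ι]
    (β : MultilinearMap ℝ (fun _ : ι => V) N) : Continuous β := by
  classical
  let b := Module.finBasis ℝ V
  have h : (β : (ι → V) → N) = fun v => ∑ r : ι → Fin (Module.finrank ℝ V),
      (∏ i, b.equivFun.toContinuousLinearEquiv (v i) (r i)) • β fun i => b (r i) := by
    ext v
    conv_lhs => rw [show v = fun i => ∑ j, b.repr (v i) j • b j from
      funext fun i => (b.sum_repr (v i)).symm]
    rw [β.map_sum]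
    refine Finset.sum_congr rfl fun r _ => ?_
    rw [β.map_smul_univ]
    rfl
  rw [h]
  refine continuous_finsetSum _ fun r _ => Continuous.smul (continuous_finsetProd _ fun i _ => ?_)
    continuous_const
  exact (continuous_apply (r i)).comp ((ContinuousLinearEquiv.continuous _).comp
    (continuous_apply i))

/-- An alternating map on a finite-dimensional space as a continuous alternating map. -/
def AlternatingMap.toContinuous {m : ℕ} (β : V [⋀^Fin m]→ₗ[ℝ] N) : V [⋀^Fin m]→L[ℝ] N where
  toMultilinearMap := β.toMultilinearMap
  cont := β.toMultilinearMap.continuous_of_finiteDimensional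
  map_eq_zero_of_eq' := β.map_eq_zero_of_eq'

/-- The derivative of an alternating map evaluated at differentiable vectors. -/
theorem AlternatingMap.hasFDerivAt_comp {W : Type*} [NormedAddCommGroup W] [NormedSpace ℝ W]
    {m : ℕ} (β : V [⋀^Fin m]→ₗ[ℝ] N) {g : Fin m → W → V} {g' : Fin m → W →L[ℝ] V} {x : W}
    (hg : ∀ i, HasFDerivAt (g i) (g' i) x) :
    ∃ T : W →L[ℝ] N, HasFDerivAt (fun u => β fun i => g i u) T x ∧
      ∀ w, T w = ∑ j, β (Function.update (fun i => g i x) j (g' j w)) := by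
  refine ⟨_, HasFDerivAt.multilinear_comp (E := fun _ : Fin m => V)
    β.toContinuous.toContinuousMultilinearMap hg, fun w => ?_⟩
  simp only [sum_apply, ContinuousLinearMap.comp_apply]
  rfl

end FiniteDimensional

section Coordinates

set_option linter.unusedSectionVars false

variable {V : Type*} [NormedAddCommGroup V] [NormedSpace ℝ V] [FiniteDimensional ℝ V] {k : ℕ}

/-- The pullback of a constant form is closed, in coordinates. -/
theorem sum_neg_one_pow_fderiv_eq_zero {W : Type*} [NormedAddCommGroup W] [NormedSpace ℝ W]
    {f : W → V} {u₀ : W} (hf : ContDiffAt ℝ 2 f u₀) (α : V [⋀^Fin k]→ₗ[ℝ] ℝ)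
    (e : Fin (k + 1) → W) :
    ∑ i : Fin (k + 1), (-1 : ℝ) ^ (i : ℕ) *
      fderiv ℝ (fun u => α fun l => fderiv ℝ f u (e (i.succAbove l))) u₀ (e i) = 0 := by
  have hω : DifferentiableAt ℝ (fun u => α.toContinuous.compContinuousLinearMap (fderiv ℝ f u))
      u₀ := by
    have h1 : DifferentiableAt ℝ (fderiv ℝ f) u₀ :=
      (hf.fderiv_right (m := 1) (by rw [one_add_one_eq_two])).differentiableAt one_ne_zero
    exact ((hasFDerivAt_const α.toContinuous
      u₀).continuousAlternatingMapCompContinuousLinearMap h1.hasFDerivAt).differentiableAt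
  have h := extDeriv_apply hω e
  have hpull := extDeriv_pullback (f := f) (x := u₀)
    (differentiableAt_const α.toContinuous) hf (by simp)
  rw [hpull] at h
  -- The exterior derivative commutes with pullback, and a constant form is closed.
  have h0 : extDeriv (fun _ : V => α.toContinuous) (f u₀) = 0 := by
    ext v
    rw [extDeriv_apply (differentiableAt_const _)]
    simp
  rw [h0] at h
  refine Eq.trans (Finset.sum_congr rfl fun i _ => ?_) h.symm
  change _ = ((-1 : ℤ) ^ (i : ℕ)) • fderiv ℝ (fun u => α fun l => fderiv ℝ f u
    (e (i.succAbove l))) u₀ (e i)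
  rw [zsmul_eq_mul]
  push_cast
  rfl

/-- Replacing one vector of a family by a linear combination of the family. -/
theorem AlternatingMap.map_update_sum_smul {V N : Type*} [AddCommGroup V] [Module ℝ V]
    [AddCommGroup N] [Module ℝ N] {m : ℕ}
    (β : V [⋀^Fin m]→ₗ[ℝ] N) (g : Fin m → V) (j : Fin m) (c : Fin m → ℝ) :
    β (Function.update g j (∑ i, c i • g i)) = c j • β g := by
  rw [β.map_update_sum, Finset.sum_eq_single j]
  · rw [β.map_update_smul, Function.update_eq_self]
  · intro i _ hi
    rw [β.map_update_smul, β.map_update_self _ hi.symm, smul_zero]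
  · simp

set_option maxHeartbeats 1000000 in
/-- Let `f` be an immersion from a Euclidean space of dimension `k + 1` such that `χ` is tangent to
its image. Then the contraction of `χ` with a constant form is an infinitesimal symmetry of `χ` along
the image of `f`. -/
theorem apply_contractForm_eq_exteriorDerivation {χ : V →ₗ[ℝ] ⋀[ℝ]^(k + 1) V}
    {f : EuclideanSpace ℝ (Fin (k + 1)) → V} {u₀ : EuclideanSpace ℝ (Fin (k + 1))}
    (hf : ContDiffAt ℝ 2 f u₀) (hinj : Function.Injective (fderiv ℝ f u₀))
    (hχ : ∀ᶠ u in 𝓝 u₀, χ (f u) ∈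
      LinearMap.range (exteriorPower.map (k + 1) (fderiv ℝ f u).toLinearMap))
    (α : V [⋀^Fin k]→ₗ[ℝ] ℝ) :
    χ (contractForm α (χ (f u₀))) =
      exteriorDerivation (k + 1) (contractForm α ∘ₗ χ) (χ (f u₀)) := by
  let e := (EuclideanSpace.basisFun (Fin (k + 1)) ℝ).toBasis
  let g : Fin (k + 1) → EuclideanSpace ℝ (Fin (k + 1)) → V := fun i u => fderiv ℝ f u (e i)
  set S := fderiv ℝ (fderiv ℝ f) u₀ with hS
  have hSsymm : ∀ v w, S v w = S w v := hf.isSymmSndFDerivAt (by simp)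
  have hd2 : HasFDerivAt (fderiv ℝ f) S u₀ :=
    ((hf.fderiv_right (m := 1) (by rw [one_add_one_eq_two])).differentiableAt
      one_ne_zero).hasFDerivAt
  have hd1 : HasFDerivAt f (fderiv ℝ f u₀) u₀ := (hf.differentiableAt two_ne_zero).hasFDerivAt
  have hg : ∀ i, HasFDerivAt (g i) (S.flip (e i)) u₀ := fun i =>
    (ContinuousLinearMap.apply ℝ V (e i)).hasFDerivAt.comp u₀ hd2
  -- the coefficient of `χ` in coordinates
  obtain ⟨π, hπ⟩ := (fderiv ℝ f u₀).toLinearMap.exists_leftInverse_of_injective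
    (LinearMap.ker_eq_bot.2 hinj)
  -- A form equal to `1` on the coordinate frame at `u₀`; dividing by its value on the moving frame
  -- isolates the coefficient `ρ` of `χ` and shows that `ρ` is differentiable.
  let β₀ : V [⋀^Fin (k + 1)]→ₗ[ℝ] ℝ := e.det.compLinearMap π
  let Φ : (V [⋀^Fin (k + 1)]→ₗ[ℝ] ℝ) → V →ₗ[ℝ] ℝ := fun β =>
    exteriorPower.alternatingMapLinearEquiv β ∘ₗ χ
  have hΦd : ∀ β, HasFDerivAt (fun u => Φ β (f u))
      ((LinearMap.toContinuousLinearMap (Φ β)).comp (fderiv ℝ f u₀)) u₀ := fun β =>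
    (LinearMap.toContinuousLinearMap (Φ β)).hasFDerivAt.comp u₀ hd1
  let ρ : EuclideanSpace ℝ (Fin (k + 1)) → ℝ := fun u => Φ β₀ (f u) / β₀ fun i => g i u
  obtain ⟨T₀, hT₀, -⟩ := β₀.hasFDerivAt_comp hg
  have hβ₀ : β₀ (fun i => g i u₀) = 1 := by
    have : (fun i => π (g i u₀)) = e := funext fun i => LinearMap.congr_fun hπ (e i)
    change e.det (fun i => π (g i u₀)) = 1
    rw [this, e.det_self]
  have hρd : DifferentiableAt ℝ ρ u₀ := by
    have h1 := (hΦd β₀).differentiableAt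
    have h2 := hT₀.differentiableAt
    simp only [ρ, div_eq_mul_inv]
    exact h1.mul (DifferentiableAt.fun_inv h2 (hβ₀.trans_ne one_ne_zero))
  have hχρ : ∀ᶠ u in 𝓝 u₀, χ (f u) = ρ u • exteriorPower.ιMulti ℝ (k + 1) fun i => g i u := by
    have hne : ∀ᶠ u in 𝓝 u₀, β₀ (fun i => g i u) ≠ 0 := by
      refine hT₀.continuousAt.eventually_ne ?_
      exact hβ₀.trans_ne one_ne_zero
    filter_upwards [hχ, hne] with u ⟨η, hη⟩ hu
    obtain ⟨c, rfl⟩ := exists_smul_ιMulti_basis e η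
    rw [map_smul, exteriorPower.map_apply_ιMulti] at hη
    have hη' : χ (f u) = c • exteriorPower.ιMulti ℝ (k + 1) fun i => g i u := hη.symm
    have hc : ρ u = c := by
      change exteriorPower.alternatingMapLinearEquiv β₀ (χ (f u)) / _ = c
      rw [hη', map_smul, exteriorPower.alternatingMapLinearEquiv_apply_ιMulti, smul_eq_mul,
        mul_div_cancel_right₀ _ hu]
    rw [hc, hη']
  have hρ : HasFDerivAt ρ (fderiv ℝ ρ u₀) u₀ := hρd.hasFDerivAt
  -- the components of the contraction, up to the factor `ρ`
  have hwd : ∀ i : Fin (k + 1), HasFDerivAt (fun u => α fun l => g (i.succAbove l) u)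
      (fderiv ℝ (fun u => α fun l => g (i.succAbove l) u) u₀) u₀ := fun i => by
    obtain ⟨T, hT, -⟩ := α.hasFDerivAt_comp fun l => hg (i.succAbove l)
    exact hT.differentiableAt.hasFDerivAt
  let w : Fin (k + 1) → EuclideanSpace ℝ (Fin (k + 1)) → ℝ := fun i u =>
    (-1 : ℝ) ^ (i : ℕ) * α fun l => g (i.succAbove l) u
  let w' : Fin (k + 1) → EuclideanSpace ℝ (Fin (k + 1)) →L[ℝ] ℝ := fun i =>
    (-1 : ℝ) ^ (i : ℕ) • fderiv ℝ (fun u => α fun l => g (i.succAbove l) u) u₀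
  have hw : ∀ i, HasFDerivAt (w i) (w' i) u₀ := fun i => (hwd i).const_mul _
  -- Closedness of the pullback of `α` says exactly that the coordinate field with components `w i`
  -- has zero divergence at `u₀`.
  have hdiv : ∑ i, w' i (e i) = 0 := sum_neg_one_pow_fderiv_eq_zero hf α e
  let A : V →ₗ[ℝ] V := contractForm α ∘ₗ χ
  have hA : ∀ᶠ u in 𝓝 u₀, A (f u) = ∑ i, (ρ u * w i u) • g i u := by
    filter_upwards [hχρ] with u hu
    change contractForm α (χ (f u)) = _
    rw [hu, map_smul, contractForm_ιMulti, Finset.smul_sum]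
    refine Finset.sum_congr rfl fun i _ => ?_
    rw [smul_smul, smul_smul, mul_assoc]
  let W := ∑ i, w i u₀ • e i
  -- `A` is linear, so its value on a tangent vector is the derivative of `A ∘ f`, which the
  -- coordinate formula `hA` computes. The second derivative `S` of `f` enters from differentiating
  -- the frame.
  have hAd : ∀ v, A (fderiv ℝ f u₀ v) = ∑ i, (ρ u₀ * w' i v + fderiv ℝ ρ u₀ v * w i u₀) • g i u₀ +
      ρ u₀ • S v W := by
    intro v
    have h1 : HasFDerivAt (fun u => A (f u))
        ((LinearMap.toContinuousLinearMap A).comp (fderiv ℝ f u₀)) u₀ :=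
      (LinearMap.toContinuousLinearMap A).hasFDerivAt.comp u₀ hd1
    have h2 := (HasFDerivAt.fun_sum (u := Finset.univ)
      fun i _ => (hρ.mul (hw i)).smul (hg i)).congr_of_eventuallyEq hA
    have h3 := congrArg (fun T => T v) (h1.unique h2)
    simp only [sum_apply] at h3
    refine Eq.trans h3 ?_
    have h4 : ρ u₀ • S v W = ∑ i, (ρ u₀ * w i u₀) • S v (e i) := by
      simp [W, map_sum, Finset.smul_sum, smul_smul]
    rw [h4, ← Finset.sum_add_distrib]
    refine Finset.sum_congr rfl fun i _ => ?_
    change (ρ u₀ * w i u₀) • S v (e i) +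
      (ρ u₀ * w' i v + w i u₀ * fderiv ℝ ρ u₀ v) • g i u₀ = _
    rw [add_comm, mul_comm (w i u₀)]
  have hAf : A (f u₀) = ρ u₀ • fderiv ℝ f u₀ W := by
    rw [hA.self_of_nhds]
    simp [W, map_sum, Finset.smul_sum, smul_smul, g]
  -- Tested against `β`, one side is the derivative of `ρ * β (frame)` along `ρ u₀ • W`, the other
  -- the derivation applied to the frame. The terms in `S` agree by symmetry of second derivatives,
  -- the terms in `fderiv ℝ ρ` agree, and the remaining ones sum to the divergence.
  refine exteriorPower_eq_of_forall fun β => ?_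
  obtain ⟨T, hT, hT'⟩ := β.hasFDerivAt_comp hg
  have hΦβ : ∀ᶠ u in 𝓝 u₀, Φ β (f u) = ρ u * β fun i => g i u := by
    filter_upwards [hχρ] with u hu
    change exteriorPower.alternatingMapLinearEquiv β (χ (f u)) = _
    rw [hu, map_smul, exteriorPower.alternatingMapLinearEquiv_apply_ιMulti, smul_eq_mul]
  have hlhs : exteriorPower.alternatingMapLinearEquiv β (χ (A (f u₀))) =
      ρ u₀ * (ρ u₀ * T W + fderiv ℝ ρ u₀ W * β fun i => g i u₀) := by
    have h1 := (hΦd β).unique ((hρ.mul hT).congr_of_eventuallyEq hΦβ)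
    have h2 := congrArg (fun T => T (ρ u₀ • W)) h1
    have h3 : Φ β (A (f u₀)) = (ρ u₀ • T + (β fun i => g i u₀) • fderiv ℝ ρ u₀) (ρ u₀ • W) := by
      rw [hAf, ← map_smul]
      exact h2
    refine h3.trans ?_
    rw [map_smul]
    change ρ u₀ * (ρ u₀ * T W + (β fun i => g i u₀) * fderiv ℝ ρ u₀ W) = _
    ring
  have hrhs : exteriorPower.alternatingMapLinearEquiv β
      (exteriorDerivation (k + 1) A (χ (f u₀))) =
      ρ u₀ * ∑ j, β (Function.update (fun i => g i u₀) j (A (g j u₀))) := by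
    rw [hχρ.self_of_nhds, map_smul, exteriorDerivation_ιMulti, map_smul, map_sum, smul_eq_mul]
    simp only [exteriorPower.alternatingMapLinearEquiv_apply_ιMulti]
  refine hlhs.trans (Eq.trans ?_ hrhs.symm)
  congr 1
  have hterm : ∀ j, β (Function.update (fun i => g i u₀) j (A (g j u₀))) =
      (ρ u₀ * w' j (e j) + fderiv ℝ ρ u₀ (e j) * w j u₀) * β (fun i => g i u₀) +
      ρ u₀ * β (Function.update (fun i => g i u₀) j (S.flip (e j) W)) := by
    intro j
    change β (Function.update _ j (A (fderiv ℝ f u₀ (e j)))) = _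
    rw [hAd, β.map_update_add, β.map_update_smul, β.map_update_sum_smul, smul_eq_mul, smul_eq_mul,
      hSsymm]
    rfl
  simp only [hterm, Finset.sum_add_distrib, ← Finset.mul_sum, ← Finset.sum_mul, hdiv, hT',
    mul_zero, zero_add]
  have hρW : fderiv ℝ ρ u₀ W = ∑ j, fderiv ℝ ρ u₀ (e j) * w j u₀ := by
    simp [W, map_sum, mul_comm]
  rw [hρW]
  ring

end Coordinates
end

/-! ### From infinitesimal invariance to invariance under exponentials -/

noncomputable section
open Filter Topology Set

section Invariance

variable {V : Type*} [NormedAddCommGroup V] [NormedSpace ℝ V] [FiniteDimensional ℝ V]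

/-- By linearity in `η` it suffices to treat decomposable multivectors, where this is the product
rule for an alternating map. -/
theorem hasDerivAt_map_exp_neg {m : ℕ} (A : V →L[ℝ] V) (β : V [⋀^Fin m]→ₗ[ℝ] ℝ)
    (η : ⋀[ℝ]^m V) (t : ℝ) :
    HasDerivAt (fun s : ℝ => exteriorPower.alternatingMapLinearEquiv β
        (exteriorPower.map m (NormedSpace.exp (-(s • A))).toLinearMap η))
      (-exteriorPower.alternatingMapLinearEquiv β
        (exteriorPower.map m (NormedSpace.exp (-(t • A))).toLinearMap
          (exteriorDerivation m A.toLinearMap η))) t := by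
  have hη : η ∈ Submodule.span ℝ (Set.range (exteriorPower.ιMulti ℝ m (M := V))) := by
    rw [exteriorPower.ιMulti_span]; exact Submodule.mem_top
  induction hη using Submodule.span_induction with
  | mem x hx =>
    obtain ⟨v, rfl⟩ := hx
    have hg : ∀ i, HasFDerivAt (fun s : ℝ => NormedSpace.exp (-(s • A)) (v i))
        (ContinuousLinearMap.toSpanSingleton ℝ (-(NormedSpace.exp (-(t • A)) (A (v i))))) t := by
      intro i
      have := (ContinuousLinearMap.apply ℝ V (v i)).hasFDerivAt.comp_hasDerivAt t
        (hasDerivAt_exp_neg_smul A t)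
      exact this.hasFDerivAt
    obtain ⟨T, hT, hT'⟩ := β.hasFDerivAt_comp hg
    have h2 := hT.hasDerivAt
    simp only [exteriorPower.map_apply_ιMulti, exteriorDerivation_ιMulti, map_sum,
      exteriorPower.alternatingMapLinearEquiv_apply_ιMulti]
    refine h2.congr_deriv ?_
    rw [hT', ← Finset.sum_neg_distrib]
    refine Finset.sum_congr rfl fun j _ => ?_
    rw [ContinuousLinearMap.toSpanSingleton_apply, one_smul, β.map_update_neg]
    congr 2
    ext i
    rcases eq_or_ne i j with rfl | h
    · simp
    · simp [h]
  | zero => simpa using hasDerivAt_const t (0 : ℝ)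
  | add x y _ _ hx hy =>
    simp only [map_add, neg_add]
    exact hx.add hy
  | smul c x _ hx =>
    simp only [map_smul, smul_eq_mul, ← mul_neg]
    exact hx.const_mul c

/-- If a linear map `χ` from `V` to an exterior power of `V` is infinitesimally invariant under an
endomorphism, it is invariant under its exponential. -/
theorem apply_exp_eq_map_exp {m : ℕ} {χ : V →ₗ[ℝ] ⋀[ℝ]^m V} {A : V →L[ℝ] V}
    (hA : ∀ x, χ (A x) = exteriorDerivation m A.toLinearMap (χ x)) (x : V) :
    χ (NormedSpace.exp A x) = exteriorPower.map m (NormedSpace.exp A).toLinearMap (χ x) := by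
  suffices h : exteriorPower.map m (NormedSpace.exp (-A)).toLinearMap (χ (NormedSpace.exp A x)) =
      χ x by
    rw [← h, ← LinearMap.comp_apply, ← exteriorPower.map_comp]
    have : (NormedSpace.exp A).toLinearMap ∘ₗ (NormedSpace.exp (-A)).toLinearMap =
        LinearMap.id := by
      ext v
      exact congrArg (fun T : V →L[ℝ] V => T v) (exp_mul_exp_neg A)
    rw [this, exteriorPower.map_id, LinearMap.id_apply]
  refine exteriorPower_eq_of_forall fun β => ?_
  let b := Module.finBasis ℝ V
  -- Pulling `χ` back along the flow, `Ψ t (c t)` is constant: moving the point contributes `Ψ t (A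
  -- (c t))`, and by `hA` moving the functional contributes its negative. The basis `b` reduces the
  -- derivative of this pairing to derivatives of scalar functions.
  let Ψ : ℝ → V →ₗ[ℝ] ℝ := fun t => exteriorPower.alternatingMapLinearEquiv β ∘ₗ
    exteriorPower.map m (NormedSpace.exp (-(t • A))).toLinearMap ∘ₗ χ
  let c : ℝ → V := fun t => NormedSpace.exp (t • A) x
  have hc : ∀ t, HasDerivAt c (A (c t)) t := by
    intro t
    have : CompleteSpace (V →L[ℝ] V) := FiniteDimensional.complete ℝ _
    exact (ContinuousLinearMap.apply ℝ V x).hasFDerivAt.comp_hasDerivAt t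
      (hasDerivAt_exp_smul_const' (𝕂 := ℝ) A t)
  have hΨ : ∀ t y, Ψ t y = ∑ i, b.repr y i * Ψ t (b i) := by
    intro t y
    conv_lhs => rw [← b.sum_repr y]
    simp only [map_sum, map_smul, smul_eq_mul]
  have hΨd : ∀ t y, HasDerivAt (fun s => Ψ s y) (-Ψ t (A y)) t := by
    intro t y
    have h := hasDerivAt_map_exp_neg A β (χ y) t
    rw [← hA] at h
    exact h
  have hd : ∀ t, HasDerivAt (fun t => Ψ t (c t)) 0 t := by
    intro t
    have hcoord : ∀ i, HasDerivAt (fun s => b.repr (c s) i) (b.repr (A (c t)) i) t := fun i =>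
      (LinearMap.toContinuousLinearMap (b.coord i)).hasFDerivAt.comp_hasDerivAt t (hc t)
    have h1 : HasDerivAt (fun t => Ψ t (c t)) (∑ i, (b.repr (A (c t)) i * Ψ t (b i) +
        b.repr (c t) i * -Ψ t (A (b i)))) t := by
      refine (HasDerivAt.fun_sum (u := Finset.univ)
        fun i _ => (hcoord i).mul (hΨd t (b i))).congr_of_eventuallyEq ?_
      exact Eventually.of_forall fun s => hΨ s (c s)
    refine h1.congr_deriv ?_
    have h2 : ∑ i, b.repr (c t) i * Ψ t (A (b i)) = Ψ t (A (c t)) := by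
      conv_rhs => rw [← b.sum_repr (c t)]
      simp only [map_sum, map_smul, smul_eq_mul]
    rw [Finset.sum_add_distrib, ← hΨ]
    simp only [mul_neg, Finset.sum_neg_distrib]
    rw [h2, add_neg_cancel]
  have hconst := is_const_of_deriv_eq_zero (fun t => (hd t).differentiableAt)
    (fun t => (hd t).deriv) 1 0
  simp only [Ψ, c, one_smul, zero_smul, neg_zero, NormedSpace.exp_zero] at hconst
  refine hconst.trans ?_
  change exteriorPower.alternatingMapLinearEquiv β (exteriorPower.map m LinearMap.id (χ x)) = _
  rw [exteriorPower.map_id]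
  rfl

end Invariance

/-! ### Differentials in charts -/

section Charts

variable {d : ℕ} {M : Type*} [TopologicalSpace M] [ChartedSpace (EuclideanSpace ℝ (Fin d)) M]
  [IsManifold (𝓡 d) ∞ M] {F : Type*} [NormedAddCommGroup F] [NormedSpace ℝ F]

theorem contDiffAt_comp_extChartAt_symm {ι : M → F} (hι : ContMDiff (𝓡 d) 𝓘(ℝ, F) ∞ ι) (p : M)
    {u : EuclideanSpace ℝ (Fin d)} (hu : u ∈ (extChartAt (𝓡 d) p).target) :
    ContDiffAt ℝ ∞ (ι ∘ (extChartAt (𝓡 d) p).symm) u := by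
  rw [← contMDiffAt_iff_contDiffAt]
  refine (hι _).comp u ?_
  exact (contMDiffOn_extChartAt_symm p).contMDiffAt ((isOpen_extChartAt_target p).mem_nhds hu)

/-- The derivative of a map in a chart agrees with its differential up to a linear isomorphism. -/
theorem exists_fderiv_comp_extChartAt_symm {ι : M → F} (hι : ContMDiff (𝓡 d) 𝓘(ℝ, F) ∞ ι)
    (p : M) {u : EuclideanSpace ℝ (Fin d)} (hu : u ∈ (extChartAt (𝓡 d) p).target) :
    ∃ T : EuclideanSpace ℝ (Fin d) ≃ₗ[ℝ] EuclideanSpace ℝ (Fin d),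
      (fderiv ℝ (ι ∘ (extChartAt (𝓡 d) p).symm) u).toLinearMap =
        differentialAt (d := d) ι ((extChartAt (𝓡 d) p).symm u) ∘ₗ T.toLinearMap := by
  have h1 : (mfderivWithin 𝓘(ℝ, EuclideanSpace ℝ (Fin d)) (𝓡 d) (extChartAt (𝓡 d) p).symm
      (range (𝓡 d)) u).IsInvertible :=
    have : IsManifold (𝓡 d) 1 M := IsManifold.of_le (n := ∞) (by simp)
    isInvertible_mfderivWithin_extChartAt_symm hu
  have hr : range (𝓡 d) = univ := ModelWithCorners.Boundaryless.range_eq_univ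
  rw [hr, mfderivWithin_univ] at h1
  obtain ⟨T, hT⟩ := h1
  refine ⟨T.toLinearEquiv, ?_⟩
  have hs : MDifferentiableAt 𝓘(ℝ, EuclideanSpace ℝ (Fin d)) (𝓡 d) (extChartAt (𝓡 d) p).symm u :=
    ((contMDiffOn_extChartAt_symm (n := ∞) p).contMDiffAt
      ((isOpen_extChartAt_target p).mem_nhds hu)).mdifferentiableAt (by simp)
  have h2 := mfderiv_comp u ((hι _).mdifferentiableAt (by simp)) hs
  rw [← mfderiv_eq_fderiv, h2, ← hT]
  rfl

end Charts
end

/-! ### Local orbits of tangent linear fields -/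

noncomputable section
open Filter Topology Set

/-- Let `f` be an immersion to whose image the linear vector fields `j X` are tangent, and suppose
that they span the tangent space at `f u₀`. Then `X ↦ exp (j X) (f u₀)` takes values in the image
of `f` for small `X`, and is locally open as a map to the source of `f`. -/
theorem exists_lift_exp_apply {E W V : Type*} [NormedAddCommGroup E] [NormedSpace ℝ E]
    [FiniteDimensional ℝ E] [NormedAddCommGroup W] [NormedSpace ℝ W] [FiniteDimensional ℝ W]
    [NormedAddCommGroup V] [NormedSpace ℝ V] [FiniteDimensional ℝ V] {f : W → V} {u₀ : W}
    (hf : ContDiffAt ℝ 2 f u₀) (hinj : Function.Injective (fderiv ℝ f u₀)) {U : Set W}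
    (hU : U ∈ 𝓝 u₀) {j : E →L[ℝ] V →L[ℝ] V}
    (htan : ∀ u ∈ U, ∀ X, j X (f u) ∈ LinearMap.range (fderiv ℝ f u).toLinearMap)
    (hsurj : ∀ w, ∃ X, j X (f u₀) = fderiv ℝ f u₀ w) :
    ∃ R : E → W, map R (𝓝 0) = 𝓝 u₀ ∧
      ∀ᶠ X in 𝓝 (0 : E), f (R X) = NormedSpace.exp (j X) (f u₀) := by
  have : CompleteSpace E := FiniteDimensional.complete ℝ E
  have : CompleteSpace W := FiniteDimensional.complete ℝ W
  have : CompleteSpace (V →L[ℝ] V) := FiniteDimensional.complete ℝ _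
  obtain ⟨r, B, hr, hleft, hB, hcurve⟩ := exists_leftInverse_of_immersion le_rfl hf hinj hU
  let c : E → V := fun X => NormedSpace.exp (j X) (f u₀)
  have hc : ContDiff ℝ 2 c :=
    (contDiff_exp_of_finiteDimensional.comp j.contDiff).clm_apply contDiff_const
  have hc0 : c 0 = f u₀ := by simp [c, NormedSpace.exp_zero]
  have hr0 : r (f u₀) = u₀ := hleft.self_of_nhds
  -- The lift is the orbit map followed by the local left inverse of `f`. Its strict derivative at
  -- `0` is onto because the fields span the tangent space, so it maps neighbourhoods onto
  -- neighbourhoods.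
  refine ⟨fun X => r (c X), ?_, ?_⟩
  · have hd : HasFDerivAt c (j.flip (f u₀)) 0 := by
      have h2 : HasFDerivAt (NormedSpace.exp : (V →L[ℝ] V) → _) (1 : (V →L[ℝ] V) →L[ℝ] _)
          (j 0) := by
        rw [map_zero]; exact hasFDerivAt_exp_zero
      exact (ContinuousLinearMap.apply ℝ V (f u₀)).hasFDerivAt.comp (0 : E)
        (h2.comp (0 : E) j.hasFDerivAt)
    have hrd : HasFDerivAt r (fderiv ℝ r (f u₀)) (c 0) := by
      rw [hc0]; exact (hr.differentiableAt two_ne_zero).hasFDerivAt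
    have hR : HasStrictFDerivAt (fun X => r (c X))
        ((fderiv ℝ r (f u₀)).comp (j.flip (f u₀))) 0 := by
      have hr' : ContDiffAt ℝ 2 r (c 0) := by rwa [hc0]
      exact (hr'.comp (0 : E) hc.contDiffAt).hasStrictFDerivAt' (hrd.comp (0 : E) hd) two_ne_zero
    have hrf : (fderiv ℝ r (f u₀)).comp (fderiv ℝ f u₀) = ContinuousLinearMap.id ℝ W := by
      have h1 := ((hr.differentiableAt two_ne_zero).hasFDerivAt).comp u₀
        (hf.differentiableAt two_ne_zero).hasFDerivAt
      exact h1.unique ((hasFDerivAt_id u₀).congr_of_eventuallyEq hleft)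
    have hmap := hR.map_nhds_eq_of_surj (LinearMap.range_eq_top.2 fun w => by
      obtain ⟨X, hX⟩ := hsurj w
      refine ⟨X, ?_⟩
      change fderiv ℝ r (f u₀) (j X (f u₀)) = w
      rw [hX]
      exact congrArg (fun T => T w) hrf)
    rwa [hc0, hr0] at hmap
  · have hcB : ∀ᶠ X in 𝓝 (0 : E), c X ∈ B := by
      refine hc.continuous.continuousAt.eventually_mem ?_
      rwa [hc0]
    obtain ⟨δ, hδ, hball⟩ := Metric.eventually_nhds_iff_ball.1 hcB
    filter_upwards [Metric.ball_mem_nhds (0 : E) hδ] with X hX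
    -- The curve `t ↦ exp (t (j X)) (f u₀)` starts on the image of `f` and follows a tangent linear
    -- field, so it ends on the image.
    have h := hcurve (j X) (fun u hu => htan u hu X) (fun t => c (t • X)) (fun t _ => by
      have := (ContinuousLinearMap.apply ℝ V (f u₀)).hasFDerivAt.comp_hasDerivAt t
        (hasDerivAt_exp_smul_const' (𝕂 := ℝ) (j X) t)
      simp only [c, map_smul]
      exact this) (fun t ht => hball _ (by
        simp only [Metric.mem_ball, dist_zero_right, norm_smul, Real.norm_eq_abs] at hX ⊢
        refine lt_of_le_of_lt (mul_le_of_le_one_left (norm_nonneg _) ?_) hX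
        exact abs_le.2 ⟨by linarith [ht.1], ht.2⟩)) (by simp only [zero_smul, hc0, hr0])
    simpa only [one_smul] using h

/-! ### The linear fields obtained by contracting with forms -/

section Contraction

set_option linter.unusedSectionVars false

variable {V : Type*} [NormedAddCommGroup V] [NormedSpace ℝ V] [FiniteDimensional ℝ V] {k : ℕ}

/-- The linear map on `k`-forms defined by contraction with `χ`. -/
def contraction (χ : V →ₗ[ℝ] ⋀[ℝ]^(k + 1) V) : (V [⋀^Fin k]→ₗ[ℝ] ℝ) →ₗ[ℝ] V →L[ℝ] V where
  toFun α := LinearMap.toContinuousLinearMap (contractForm α ∘ₗ χ)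
  map_add' α β := by ext x; simp [contractForm_add]
  map_smul' c α := by ext x; simp [contractForm_smul]

/-- The contraction is equivariant under endomorphisms leaving `χ` invariant. -/
theorem contraction_compLinearMap {χ : V →ₗ[ℝ] ⋀[ℝ]^(k + 1) V} {g h : V →L[ℝ] V}
    (hgh : g * h = 1) (hh : ∀ x, χ (h x) = exteriorPower.map (k + 1) h.toLinearMap (χ x))
    (α : V [⋀^Fin k]→ₗ[ℝ] ℝ) :
    contraction χ (α.compLinearMap h.toLinearMap) = g * contraction χ α * h := by
  ext1 x
  change contractForm (α.compLinearMap h.toLinearMap) (χ x) = g (contractForm α (χ (h x)))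
  rw [hh, contractForm_map]
  exact (congrArg (fun T : V →L[ℝ] V => T _) hgh).symm

/-- Contraction with a tangent multivector gives tangent vectors. -/
theorem contractForm_mem_range {W : Type*} [AddCommGroup W] [Module ℝ W] {f : W →ₗ[ℝ] V}
    {η : ⋀[ℝ]^(k + 1) V} (hη : η ∈ LinearMap.range (exteriorPower.map (k + 1) f))
    (α : V [⋀^Fin k]→ₗ[ℝ] ℝ) : contractForm α η ∈ LinearMap.range f := by
  obtain ⟨ζ, rfl⟩ := hη
  exact ⟨_, (contractForm_map f α ζ).symm⟩

/-- Contraction with a nonzero tangent multivector of top degree gives all tangent vectors. -/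
theorem exists_contractForm_eq {f : EuclideanSpace ℝ (Fin (k + 1)) →ₗ[ℝ] V}
    (hf : Function.Injective f) {η : ⋀[ℝ]^(k + 1) V} (hη0 : η ≠ 0)
    (hη : η ∈ LinearMap.range (exteriorPower.map (k + 1) f))
    (w : EuclideanSpace ℝ (Fin (k + 1))) :
    ∃ α : V [⋀^Fin k]→ₗ[ℝ] ℝ, contractForm α η = f w := by
  let e := (EuclideanSpace.basisFun (Fin (k + 1)) ℝ).toBasis
  obtain ⟨π, hπ⟩ := f.exists_leftInverse_of_injective (LinearMap.ker_eq_bot.2 hf)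
  obtain ⟨ζ, rfl⟩ := hη
  obtain ⟨c, rfl⟩ := exists_smul_ιMulti_basis e ζ
  have hc : c ≠ 0 := by
    rintro rfl
    exact hη0 (by simp)
  -- The volume form contracted with `w`, normalised by the coefficient `c` of the multivector and
  -- extended to `V` through the left inverse `π` of `f`.
  refine ⟨(c⁻¹ • e.det.curryLeft w).compLinearMap π, ?_⟩
  have h : ((c⁻¹ • e.det.curryLeft w).compLinearMap π).compLinearMap f =
      c⁻¹ • e.det.curryLeft w := by
    ext v
    have : (fun i => π (f (v i))) = v := funext fun i => LinearMap.congr_fun hπ (v i)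
    simp [this]
  rw [contractForm_map, h, contractForm_smul, LinearMap.smul_apply, map_smul (contractForm _),
    contractForm_det_curryLeft, smul_smul, inv_mul_cancel₀ hc, one_smul]

end Contraction

/-! ### The Lie algebra of contractions and the action of its group on the submanifold -/

section EvolutionData

variable {k n : ℕ} {M : Type*} [TopologicalSpace M]
  [ChartedSpace (EuclideanSpace ℝ (Fin (k + 1))) M] [IsManifold (𝓡 (k + 1)) ∞ M]
  {ι : M → RSpace n} {χ : RSpace n →ₗ[ℝ] ⋀[ℝ]^(k + 1) (RSpace n)}

namespace IsNonsingularLinearEvolutionData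

variable (hP : IsNonsingularLinearEvolutionData ι χ)
include hP

theorem mem_range_map_fderiv (p : M) {u : EuclideanSpace ℝ (Fin (k + 1))}
    (hu : u ∈ (extChartAt (𝓡 (k + 1)) p).target) :
    χ ((ι ∘ (extChartAt (𝓡 (k + 1)) p).symm) u) ∈ LinearMap.range (exteriorPower.map (k + 1)
      (fderiv ℝ (ι ∘ (extChartAt (𝓡 (k + 1)) p).symm) u).toLinearMap) := by
  obtain ⟨T, hT⟩ := exists_fderiv_comp_extChartAt_symm hP.immersion.contMDiff p hu
  obtain ⟨η, hη⟩ := hP.tangent ((extChartAt (𝓡 (k + 1)) p).symm u)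
  refine ⟨exteriorPower.map (k + 1) T.symm.toLinearMap η, ?_⟩
  rw [hT, ← LinearMap.comp_apply, ← exteriorPower.map_comp, LinearMap.comp_assoc,
    LinearEquiv.comp_coe, LinearEquiv.symm_trans_self]
  exact hη

theorem injective_fderiv (p : M) {u : EuclideanSpace ℝ (Fin (k + 1))}
    (hu : u ∈ (extChartAt (𝓡 (k + 1)) p).target) :
    Function.Injective (fderiv ℝ (ι ∘ (extChartAt (𝓡 (k + 1)) p).symm) u) := by
  obtain ⟨T, hT⟩ := exists_fderiv_comp_extChartAt_symm hP.immersion.contMDiff p hu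
  have h : Function.Injective (fderiv ℝ (ι ∘ (extChartAt (𝓡 (k + 1)) p).symm) u).toLinearMap := by
    rw [hT]
    exact (hP.immersion.injective_differential _).comp T.injective
  exact h

theorem contDiffAt (p : M) {u : EuclideanSpace ℝ (Fin (k + 1))}
    (hu : u ∈ (extChartAt (𝓡 (k + 1)) p).target) :
    ContDiffAt ℝ 2 (ι ∘ (extChartAt (𝓡 (k + 1)) p).symm) u :=
  (contDiffAt_comp_extChartAt_symm hP.immersion.contMDiff p hu).of_le
    (WithTop.coe_le_coe.2 (le_top : (2 : ℕ∞) ≤ ⊤))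

/-- Contractions of `χ` with constant forms are infinitesimal symmetries of `χ`. -/
theorem apply_contraction (α : RSpace n [⋀^Fin k]→ₗ[ℝ] ℝ) (x : RSpace n) :
    χ (contraction χ α x) =
      exteriorDerivation (k + 1) (contraction χ α).toLinearMap (χ x) := by
  -- Both sides are linear in `x`, so they agree on a subspace; it contains `P` and is therefore
  -- everything.
  have h : LinearMap.eqLocus (χ ∘ₗ (contraction χ α).toLinearMap)
      (exteriorDerivation (k + 1) (contraction χ α).toLinearMap ∘ₗ χ) = ⊤ := by
    apply hP.not_in_proper
    rintro _ ⟨p, rfl⟩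
    have h0 := mem_extChartAt_target (I := 𝓡 (k + 1)) p
    have h := apply_contractForm_eq_exteriorDerivation (hP.contDiffAt p h0)
      (hP.injective_fderiv p h0) (by
        filter_upwards [extChartAt_target_mem_nhds (I := 𝓡 (k + 1)) p] with u hu
        exact hP.mem_range_map_fderiv p hu) α
    rw [Function.comp_apply, extChartAt_to_inv] at h
    exact h
  exact (h ▸ Submodule.mem_top : x ∈ LinearMap.eqLocus _ _)

theorem apply_exp_contraction (α : RSpace n [⋀^Fin k]→ₗ[ℝ] ℝ) (x : RSpace n) :
    χ (NormedSpace.exp (contraction χ α) x) =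
      exteriorPower.map (k + 1) (NormedSpace.exp (contraction χ α)).toLinearMap (χ x) :=
  apply_exp_eq_map_exp (hP.apply_contraction α) x

/-- The space of contractions of `χ` with constant forms is the Lie algebra of a Lie group. -/
theorem exists_integrableSubspace :
    ∃ (d : ℕ) (D : IntegrableSubspace (EuclideanSpace ℝ (Fin d)) (RglAlg n)),
      LinearMap.range D.toCLM.toLinearMap = LinearMap.range (contraction χ) := by
  let 𝔤 := LinearMap.range (contraction χ)
  let e : EuclideanSpace ℝ (Fin (Module.finrank ℝ 𝔤)) ≃L[ℝ] 𝔤 :=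
    ContinuousLinearEquiv.ofFinrankEq (by simp)
  refine ⟨_, ⟨𝔤.subtypeL.comp e.toContinuousLinearMap,
    Subtype.val_injective.comp e.injective, fun X Y => ?_⟩, ?_⟩
  · obtain ⟨α, hα⟩ := (e X).2
    obtain ⟨β, hβ⟩ := (e Y).2
    -- By equivariance, conjugating the contraction of `β` by `exp A` gives the contraction of the
    -- pullback of `β` by `exp (-A)`. This requires `exp (-A)` to preserve `χ`, which holds since
    -- `-A` is the contraction of `-α`.
    refine ⟨e.symm ⟨_, β.compLinearMap (NormedSpace.exp (-(contraction χ α))).toLinearMap, rfl⟩,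
      ?_⟩
    change NormedSpace.exp (e X : RglAlg n) * (e Y : RglAlg n) *
      NormedSpace.exp (-(e X : RglAlg n)) = ((e (e.symm _) : 𝔤) : RglAlg n)
    rw [← hα, ← hβ, ContinuousLinearEquiv.apply_symm_apply]
    refine (contraction_compLinearMap (exp_mul_exp_neg _) (fun x => ?_) β).symm
    rw [← map_neg]
    exact hP.apply_exp_contraction (-α) x
  · apply le_antisymm
    · rintro _ ⟨X, rfl⟩
      exact (e X).2
    · intro A hA
      exact ⟨e.symm ⟨A, hA⟩, congrArg Subtype.val (e.apply_symm_apply ⟨A, hA⟩)⟩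

variable {d : ℕ} {D : IntegrableSubspace (EuclideanSpace ℝ (Fin d)) (RglAlg n)}
  (hD : LinearMap.range D.toCLM.toLinearMap = LinearMap.range (contraction χ))
include hD

theorem apply_val (g : D.Grp) (x : RSpace n) :
    χ (D.val g x) = exteriorPower.map (k + 1) (D.val g).toLinearMap (χ x) := by
  induction g using D.grp_induction with
  | h1 =>
    change χ x = exteriorPower.map (k + 1) LinearMap.id (χ x)
    rw [exteriorPower.map_id]
    rfl
  | hexp X g ih =>
    obtain ⟨α, hα⟩ : D.toCLM X ∈ LinearMap.range (contraction χ) := hD ▸ ⟨X, rfl⟩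
    have h := hP.apply_exp_contraction α (D.val g x)
    rw [hα, ih, ← LinearMap.comp_apply, ← exteriorPower.map_comp] at h
    exact h

/-- Local structure of the orbits of the group near a point of `P`. -/
theorem exists_lift_exp (q : M) : ∃ R : EuclideanSpace ℝ (Fin d) → M, map R (𝓝 0) = 𝓝 q ∧
    ∀ᶠ X in 𝓝 0, ι (R X) = D.val (D.exp X) (ι q) := by
  have h0 := mem_extChartAt_target (I := 𝓡 (k + 1)) q
  have hq : (ι ∘ (extChartAt (𝓡 (k + 1)) q).symm) (extChartAt (𝓡 (k + 1)) q q) = ι q := by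
    rw [Function.comp_apply, extChartAt_to_inv]
  obtain ⟨R, hR, hRX⟩ := exists_lift_exp_apply (j := D.toCLM) (hP.contDiffAt q h0)
    (hP.injective_fderiv q h0) (extChartAt_target_mem_nhds (I := 𝓡 (k + 1)) q)
    (fun u hu X => by
      obtain ⟨α, hα⟩ : D.toCLM X ∈ LinearMap.range (contraction χ) := hD ▸ ⟨X, rfl⟩
      rw [← hα]
      exact contractForm_mem_range (hP.mem_range_map_fderiv q hu) α)
    (fun w => by
      obtain ⟨α, hα⟩ := exists_contractForm_eq
        (f := (fderiv ℝ (ι ∘ (extChartAt (𝓡 (k + 1)) q).symm)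
          (extChartAt (𝓡 (k + 1)) q q)).toLinearMap) (hP.injective_fderiv q h0)
        (by rw [hq]; exact hP.ne_zero q) (hP.mem_range_map_fderiv q h0) w
      obtain ⟨X, hX⟩ : contraction χ α ∈ LinearMap.range D.toCLM.toLinearMap := hD ▸ ⟨α, rfl⟩
      exact ⟨X, (congrArg (fun T : RglAlg n => T _) hX).trans hα⟩)
  rw [hq] at hRX
  refine ⟨fun X => (extChartAt (𝓡 (k + 1)) q).symm (R X), ?_, hRX⟩
  rw [← Function.comp_def, ← map_map, hR]
  have h := map_extChartAt_symm_nhdsWithin_range (I := 𝓡 (k + 1)) q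
  rwa [ModelWithCorners.Boundaryless.range_eq_univ, nhdsWithin_univ] at h

end IsNonsingularLinearEvolutionData

end EvolutionData

/-- The connected Lie subgroup of `GL(n,ℝ)` with a given integrable Lie algebra. -/
def IntegrableSubspace.toConnectedLieSubgroupGL {n d : ℕ}
    (D : IntegrableSubspace (EuclideanSpace ℝ (Fin d)) (RglAlg n)) :
    ConnectedLieSubgroupGL n where
  dim := d
  G := D.Grp
  incl := D.incl
  immersion :=
    { contMDiff := D.contMDiff_val
      injective_differential := fun g X Y h => by
        have h1 : D.val g * D.toCLM X = D.val g * D.toCLM Y := by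
          rw [← D.mfderiv_val, ← D.mfderiv_val]
          exact h
        have h2 := congrArg (D.val g⁻¹ * ·) h1
        simp only [← mul_assoc, D.val_inv_mul_val, one_mul] at h2
        exact D.injective h2
      injective := D.val_injective }

theorem IntegrableSubspace.lieAlgebra_toConnectedLieSubgroupGL {n d : ℕ}
    (D : IntegrableSubspace (EuclideanSpace ℝ (Fin d)) (RglAlg n)) :
    D.toConnectedLieSubgroupGL.lieAlgebra = LinearMap.range D.toCLM.toLinearMap := by
  have h : differentialAt (d := d) D.val 1 = D.toCLM.toLinearMap := by
    ext1 X
    refine (D.mfderiv_val 1 X).trans ?_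
    rw [D.val_one, one_mul]
    rfl
  exact congrArg LinearMap.range h

/-- `P` is open in an orbit of the group. -/
theorem IsNonsingularLinearEvolutionData.isOpenInOrbit {k n d : ℕ} {M : Type*}
    [TopologicalSpace M] [ConnectedSpace M] [ChartedSpace (EuclideanSpace ℝ (Fin (k + 1))) M]
    [IsManifold (𝓡 (k + 1)) ∞ M] {ι : M → RSpace n}
    {χ : RSpace n →ₗ[ℝ] ⋀[ℝ]^(k + 1) (RSpace n)} (hP : IsNonsingularLinearEvolutionData ι χ)
    {D : IntegrableSubspace (EuclideanSpace ℝ (Fin d)) (RglAlg n)}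
    (hD : LinearMap.range D.toCLM.toLinearMap = LinearMap.range (contraction χ)) (p₀ : M) :
    D.toConnectedLieSubgroupGL.IsOpenInOrbit ι (ι p₀) := by
  let O := D.toConnectedLieSubgroupGL.orbit (ι p₀)
  have hexp : ∀ X, ∀ y ∈ O, D.val (D.exp X) y ∈ O := by
    intro X y hy
    obtain ⟨g, rfl⟩ : ∃ g : D.Grp, D.val g (ι p₀) = y := hy
    exact ⟨(D.exp X * g : D.Grp), rfl⟩
  -- This uses that the lift `R` maps neighbourhoods of `0` onto neighbourhoods of `q`: nearby
  -- points of `P` are moved from `q` by arbitrarily small group elements.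
  have hev : ∀ q, ∀ N ∈ 𝓝 (0 : EuclideanSpace ℝ (Fin d)), ∀ᶠ q' in 𝓝 q,
      ∃ X ∈ N, ι q' = D.val (D.exp X) (ι q) := by
    intro q N hN
    obtain ⟨R, hR, hRX⟩ := hP.exists_lift_exp hD q
    rw [← hR]
    filter_upwards [image_mem_map (inter_mem hN hRX)]
    rintro _ ⟨X, ⟨hX, hX'⟩, rfl⟩
    exact ⟨X, hX, hX'⟩
  -- Near any `q` the points of `P` lie in the orbit of `q`, so membership in a given orbit is
  -- locally constant on `P`.
  have hclopen : IsClopen {p | ι p ∈ O} := by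
    constructor
    · rw [← isOpen_compl_iff, isOpen_iff_mem_nhds]
      intro q hq
      filter_upwards [hev q univ univ_mem] with q' hX hq'
      obtain ⟨X, -, hX⟩ := hX
      refine hq ?_
      have h := hexp (-X) _ hq'
      rw [hX, D.exp_neg] at h
      have h1 : D.val (D.exp X)⁻¹ (D.val (D.exp X) (ι q)) = ι q :=
        congrArg (fun T : RglAlg n => T (ι q)) (D.val_inv_mul_val (D.exp X))
      rwa [h1] at h
    · rw [isOpen_iff_mem_nhds]
      intro q hq
      filter_upwards [hev q univ univ_mem] with q' hX
      obtain ⟨X, -, hX⟩ := hX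
      rw [hX]
      exact hexp X _ hq
  have hall : ∀ p, ι p ∈ O := fun p => by
    have h := hclopen.eq_univ ⟨p₀, (1 : D.Grp), rfl⟩
    exact (h ▸ mem_univ p : p ∈ {p | ι p ∈ O})
  refine ⟨hall, ?_⟩
  let _ := D.toConnectedLieSubgroupGL.orbitTopology (ι p₀)
  refine Topology.IsOpenEmbedding.of_continuous_injective_isOpenMap ?_ ?_ ?_
  · refine continuous_def.2 fun U hU => isOpen_iff_mem_nhds.2 fun q hq => ?_
    obtain ⟨g, hg⟩ : ∃ g : D.Grp, D.val g (ι p₀) = ι q := hall q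
    have hU' := isOpen_coinduced.1 hU
    have hgU : rangeFactorization (fun g : D.Grp => D.val g (ι p₀)) g ∈ U := by
      have : rangeFactorization (fun g : D.Grp => D.val g (ι p₀)) g = ⟨ι q, hall q⟩ :=
        Subtype.ext hg
      rw [this]; exact hq
    have hN : ∀ᶠ X in 𝓝 0,
        rangeFactorization (fun g : D.Grp => D.val g (ι p₀)) (D.exp X * g) ∈ U :=
      IntegrableSubspace.mem_nhds_iff.1 (hU'.mem_nhds hgU)
    filter_upwards [hev q _ hN] with q' hX
    obtain ⟨X, hX, hX'⟩ := hX
    have : (⟨ι q', hall q'⟩ : O) =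
        rangeFactorization (fun g : D.Grp => D.val g (ι p₀)) (D.exp X * g) :=
      Subtype.ext (hX'.trans (congrArg (D.val (D.exp X)) hg.symm))
    rw [mem_preimage, this]
    exact hX
  · exact fun p q h => hP.immersion.injective (congrArg Subtype.val h)
  · intro W hW
    refine isOpen_coinduced.2 (isOpen_iff_mem_nhds.2 ?_)
    rintro g ⟨q, hq, hqg⟩
    have hqg' : ι q = D.val g (ι p₀) := congrArg Subtype.val hqg
    refine (IntegrableSubspace.mem_nhds_iff (D := D) (g := g)).2 ?_
    -- Here the continuity of `R` at `0` is used: small group elements move `q` within `W`.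
    obtain ⟨R, hR, hRX⟩ := hP.exists_lift_exp hD q
    have hW' : ∀ᶠ X in 𝓝 0, R X ∈ W := by
      have : W ∈ map R (𝓝 0) := hR ▸ hW.mem_nhds hq
      exact this
    filter_upwards [hW', hRX] with X h1 h2
    refine ⟨R X, h1, Subtype.ext (h2.trans ?_)⟩
    rw [hqg']
    rfl

theorem theorem4p9 {k n : ℕ} {M : Type*} [TopologicalSpace M] [ConnectedSpace M]
    [ChartedSpace (EuclideanSpace ℝ (Fin (k + 1))) M] [IsManifold (𝓡 (k + 1)) ∞ M]
    (ι : M → RSpace n) (χ : RSpace n →ₗ[ℝ] ⋀[ℝ]^(k + 1) (RSpace n))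
    (hP : IsNonsingularLinearEvolutionData ι χ) :
    ∃ S : ConnectedLieSubgroupGL n,
      -- `P` is an open subset of an orbit
      (∃ x : RSpace n, S.IsOpenInOrbit ι x) ∧
      -- `χ` is invariant
      (∀ (g : S.G) (x : RSpace n),
        χ (S.toEnd g x) = exteriorPower.map (k + 1) (S.toEnd g).toLinearMap (χ x)) ∧
      -- the contraction with `χ` is a linear map onto the Lie algebra, and it is equivariant
      ∃ L : (RSpace n [⋀^Fin k]→ₗ[ℝ] ℝ) →ₗ[ℝ] S.lieAlgebra,
        (∀ (α : RSpace n [⋀^Fin k]→ₗ[ℝ] ℝ) (x : RSpace n),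
          (L α : RglAlg n) x = contractForm α (χ x)) ∧
        Function.Surjective L ∧
        ∀ (g : S.G) (α : RSpace n [⋀^Fin k]→ₗ[ℝ] ℝ),
          (L (α.compLinearMap (S.toEnd g⁻¹).toLinearMap) : RglAlg n) =
            S.toEnd g * (L α : RglAlg n) * S.toEnd g⁻¹ := by
  obtain ⟨d, D, hD⟩ := hP.exists_integrableSubspace
  -- A connected space is nonempty, and the orbit of any point of `P` will do.
  obtain ⟨p₀⟩ : Nonempty M := inferInstance
  have hlie : D.toConnectedLieSubgroupGL.lieAlgebra = LinearMap.range (contraction χ) :=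
    D.lieAlgebra_toConnectedLieSubgroupGL.trans hD
  refine ⟨D.toConnectedLieSubgroupGL, ⟨ι p₀, hP.isOpenInOrbit hD p₀⟩, hP.apply_val hD,
    (contraction χ).codRestrict _ fun α => by rw [hlie]; exact ⟨α, rfl⟩, fun α x => rfl, ?_, ?_⟩
  · rintro ⟨A, hA⟩
    rw [hlie] at hA
    obtain ⟨α, rfl⟩ := hA
    exact ⟨α, rfl⟩
  · exact fun g α => contraction_compLinearMap (D.val_mul_val_inv g) (hP.apply_val hD g⁻¹) α

end
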